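/- Let $M$ be a compact connected (Hausdorff) smooth $n$-manifold with a projective structure, i.e. an atlas of charts which are diffeomorphisms from open subsets of $M$ onto open subsets of $\mathbb{RP}^n$ and whose changes of charts are locally restrictions of elements of $PGL(n+1,\mathbb{R})$ acting on $\mathbb{RP}^n$. Let $p:\tilde M\to M$ be the universal covering and let $D:\tilde M\to\mathbb{RP}^n$ be a developing map, i.e. a map which near every point of $\tilde M$ has the form $g\circ\varphi\circ p$ with $\varphi$ a chart of the projective structure and $g\in PGL(n+1,\mathbb{R})$. Let $\mathrm{Aut}(M,P\nabla_M)$ be the group of automorphisms of the projective structure, i.e. the diffeomorphisms of $M$ which, read in charts of the projective structure, are locally given by elements of $PGL(n+1,\mathbb{R})$, with the compact-open topology, and let $\mathrm{Aut}(M,P\nabla_M)_0$ be the connected component of its identity. If $D$ is injective and the group $\mathrm{Aut}(M,P\nabla_M)_0$ is not solvable, then $M$ admits a nontrivial smooth action of the circle group $S^1$, i.e. a smooth action in which some element of $S^1$ moves some point of $M$. -/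

import Mathlib

open scoped LinearAlgebra.Projectivization Manifold ContDiff Topology MatrixGroups

/-! ### Real projective space as a smooth manifold -/

/-- The `n`-dimensional real projective space: nonzero vectors of `ℝⁿ⁺¹` up to real scalars.
The group `PGL (n + 1, ℝ)` acts on it by Mathlib's action. -/
abbrev RealProj (n : ℕ) : Type := ℙ ℝ (Fin (n + 1) → ℝ)

namespace RealProj

/-- The quotient topology from the nonzero vectors of `ℝⁿ⁺¹`. -/
noncomputable instance instTopologicalSpace (n : ℕ) : TopologicalSpace (RealProj n) :=
  TopologicalSpace.coinduced (Projectivization.mk' (K := ℝ) (V := Fin (n + 1) → ℝ)) inferInstance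

theorem isQuotientMap_mk (n : ℕ) :
    Topology.IsQuotientMap (Projectivization.mk' (K := ℝ) (V := Fin (n + 1) → ℝ)) :=
  ⟨⟨rfl⟩, Quotient.mk''_surjective⟩

/-- The points whose `i`-th homogeneous coordinate is nonzero. -/
def affineSet {n : ℕ} (i : Fin (n + 1)) : Set (RealProj n) :=
  {x | Projectivization.lift (fun v : {v : Fin (n + 1) → ℝ // v ≠ 0} => v.1 i ≠ 0) (by
    rintro ⟨a, ha⟩ ⟨b, hb⟩ t h
    have ht : t ≠ 0 := by rintro rfl; exact ha (by simpa using h)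
    simp only at h
    simp [h, ht]) x}

@[simp] theorem mk_mem_affineSet {n : ℕ} (i : Fin (n + 1)) (v : Fin (n + 1) → ℝ) (hv : v ≠ 0) :
    (Projectivization.mk ℝ v hv : RealProj n) ∈ affineSet i ↔ v i ≠ 0 := Iff.rfl

theorem isOpen_affineSet {n : ℕ} (i : Fin (n + 1)) : IsOpen (affineSet i) := by
  rw [← (isQuotientMap_mk n).isOpen_preimage]
  exact isOpen_ne_fun ((continuous_apply i).comp continuous_subtype_val) continuous_const

/-- The affine coordinates `x_j / x_i`, `j ≠ i`. -/
noncomputable def affineCoord {n : ℕ} (i : Fin (n + 1)) (x : RealProj n) :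
    EuclideanSpace ℝ (Fin n) :=
  Projectivization.lift (fun v : {v : Fin (n + 1) → ℝ // v ≠ 0} =>
    WithLp.toLp 2 (fun j => v.1 (i.succAbove j) / v.1 i)) (by
    rintro ⟨a, ha⟩ ⟨b, hb⟩ t h
    have ht : t ≠ 0 := by rintro rfl; exact ha (by simpa using h)
    simp only at h
    subst h
    congr 1
    funext j
    exact mul_div_mul_left _ _ ht) x

@[simp] theorem affineCoord_mk {n : ℕ} (i : Fin (n + 1)) (v : Fin (n + 1) → ℝ) (hv : v ≠ 0) :
    affineCoord i (Projectivization.mk ℝ v hv) =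
      WithLp.toLp 2 (fun j => v (i.succAbove j) / v i) := rfl

theorem insertNth_ne_zero {n : ℕ} (i : Fin (n + 1)) (y : Fin n → ℝ) :
    (i.insertNth (1 : ℝ) y : Fin (n + 1) → ℝ) ≠ 0 := fun h => by
  simpa using congrFun h i

/-- The affine chart `{x_i ≠ 0} ≃ ℝⁿ` of projective space, sending `[x_0 : ⋯ : x_n]` to the
coordinates `x_j / x_i`, `j ≠ i`. -/
noncomputable def affineChart {n : ℕ} (i : Fin (n + 1)) :
    OpenPartialHomeomorph (RealProj n) (EuclideanSpace ℝ (Fin n)) where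
  toFun := affineCoord i
  invFun y := Projectivization.mk ℝ (i.insertNth (1 : ℝ) (y : Fin n → ℝ)) (insertNth_ne_zero i _)
  source := affineSet i
  target := Set.univ
  map_source' _ _ := Set.mem_univ _
  map_target' y _ := by simp
  left_inv' x hx := by
    induction x using Projectivization.ind with
    | h v hv =>
      have hi : v i ≠ 0 := hx
      rw [Projectivization.mk_eq_mk_iff']
      refine ⟨(v i)⁻¹, ?_⟩
      funext k
      rcases Fin.eq_self_or_eq_succAbove i k with rfl | ⟨j, rfl⟩
      · simp [hi]
      · simp [div_eq_inv_mul]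
  right_inv' y _ := by
    ext j
    simp
  open_source := isOpen_affineSet i
  open_target := isOpen_univ
  continuousOn_toFun := by
    refine ((isQuotientMap_mk n).continuousOn_isOpen_iff (g := affineCoord i)
      (isOpen_affineSet i)).2 ?_
    refine (PiLp.continuous_toLp 2 _).comp_continuousOn (continuousOn_pi.2 fun j => ?_)
    refine ContinuousOn.div ?_ ?_ fun v hv => hv
    · exact ((continuous_apply _).comp continuous_subtype_val).continuousOn
    · exact ((continuous_apply _).comp continuous_subtype_val).continuousOn
  continuousOn_invFun := by
    have hc : Continuous fun y : EuclideanSpace ℝ (Fin n) =>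
        (⟨i.insertNth (1 : ℝ) (y : Fin n → ℝ), insertNth_ne_zero i _⟩ :
          {v : Fin (n + 1) → ℝ // v ≠ 0}) := by
      refine Continuous.subtype_mk (continuous_pi fun k => ?_) _
      rcases Fin.eq_self_or_eq_succAbove i k with rfl | ⟨j, rfl⟩
      · simpa using continuous_const
      · simp only [Fin.insertNth_apply_succAbove]
        fun_prop
    exact ((isQuotientMap_mk n).continuous.comp hc).continuousOn

theorem exists_mem_affineSet {n : ℕ} (x : RealProj n) : ∃ i, x ∈ affineSet i := by
  induction x using Projectivization.ind with
  | h v hv => exact Function.ne_iff.1 hv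

/-- The standard smooth structure of projective space, given by its `n + 1` affine charts. -/
noncomputable instance instChartedSpace (n : ℕ) :
    ChartedSpace (EuclideanSpace ℝ (Fin n)) (RealProj n) where
  atlas := Set.range affineChart
  chartAt x := affineChart (exists_mem_affineSet x).choose
  mem_chart_source x := (exists_mem_affineSet x).choose_spec
  chart_mem_atlas _ := Set.mem_range_self _

instance instIsManifold (n : ℕ) : IsManifold (𝓡 n) ∞ (RealProj n) := by
  refine isManifold_of_contDiffOn _ _ _ ?_
  rintro _ _ ⟨i, rfl⟩ ⟨i', rfl⟩
  have hc : ∀ k : Fin (n + 1), ContDiff ℝ ∞ fun y : EuclideanSpace ℝ (Fin n) =>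
      (i.insertNth (1 : ℝ) (y : Fin n → ℝ) : Fin (n + 1) → ℝ) k := by
    intro k
    rcases Fin.eq_self_or_eq_succAbove i k with rfl | ⟨j, rfl⟩
    · simpa using contDiff_const
    · simp only [Fin.insertNth_apply_succAbove]
      fun_prop
  rw [contDiffOn_euclidean]
  intro j
  refine ContDiffOn.div (hc (i'.succAbove j)).contDiffOn (hc i').contDiffOn ?_
  rintro y ⟨⟨-, hy⟩, -⟩
  exact hy

end RealProj

/-! ### The compact-open topology on the homeomorphisms of a compact space -/

namespace Homeomorph

/-- The compact-open topology on the group of homeomorphisms. -/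
instance instCompactOpen (M : Type*) [TopologicalSpace M] : TopologicalSpace (M ≃ₜ M) :=
  TopologicalSpace.induced (fun f => (f : C(M, M))) inferInstance

/-- The homeomorphisms of a compact Hausdorff space form a topological group. -/
instance instIsTopologicalGroup (M : Type*) [TopologicalSpace M] [CompactSpace M] [T2Space M] :
    IsTopologicalGroup (M ≃ₜ M) where
  continuous_mul := by
    refine continuous_induced_rng.2 ?_
    have hc : Continuous fun f : M ≃ₜ M => (f : C(M, M)) := continuous_induced_dom
    exact (hc.comp continuous_fst).compCM (hc.comp continuous_snd)
  continuous_inv := by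
    refine continuous_induced_rng.2 ?_
    have hc : Continuous fun f : M ≃ₜ M => (f : C(M, M)) := continuous_induced_dom
    refine ContinuousMap.continuous_compactOpen.2 fun K hK U hU => ?_
    have : {f : M ≃ₜ M | Set.MapsTo ((f⁻¹ : M ≃ₜ M) : C(M, M)) K U} =
        {f : M ≃ₜ M | Set.MapsTo (f : C(M, M)) Uᶜ Kᶜ} := by
      ext f
      constructor
      · intro h x hx hxK
        exact hx (by simpa using h hxK)
      · intro h x hx
        by_contra hxU
        exact h hxU (by simpa using hx)
    simp only [Function.comp_def]
    erw [this]
    exact (ContinuousMap.isOpen_setOfPred_mapsTo hU.isClosed_compl.isCompact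
      hK.isClosed.isOpen_compl).preimage hc

end Homeomorph

/-! ### Projective structures -/

/-- A projective structure on a smooth `n`-manifold `M`: an open cover by charts which are
diffeomorphisms onto open subsets of projective space, any two of which differ, near every point
of their common domain, by an element of `PGL (n + 1, ℝ)`. -/
structure ProjectiveStructure (n : ℕ) (M : Type*) [TopologicalSpace M]
    [ChartedSpace (EuclideanSpace ℝ (Fin n)) M] where
  charts : Set (OpenPartialHomeomorph M (RealProj n))
  cover : ∀ x : M, ∃ e ∈ charts, x ∈ e.source
  smooth : ∀ e ∈ charts, ContMDiffOn (𝓡 n) (𝓡 n) ∞ e e.source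
  smooth_symm : ∀ e ∈ charts, ContMDiffOn (𝓡 n) (𝓡 n) ∞ e.symm e.target
  compatible : ∀ e ∈ charts, ∀ e' ∈ charts, ∀ x ∈ e.source, x ∈ e'.source →
    ∃ g : PGL(Fin (n + 1), ℝ), ∀ᶠ y in 𝓝 x, e' y = g • e y

namespace ProjectiveStructure

variable {n : ℕ} {M : Type*} [TopologicalSpace M] [ChartedSpace (EuclideanSpace ℝ (Fin n)) M]

/-- A map `f : M → M` is a morphism of the projective structure if it is smooth and, read in
charts near any point, it is the action of an element of `PGL (n + 1, ℝ)`. -/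
def IsMorphism (P : ProjectiveStructure n M) (f : M → M) : Prop :=
  ContMDiff (𝓡 n) (𝓡 n) ∞ f ∧
    ∀ e ∈ P.charts, ∀ e' ∈ P.charts, ∀ x ∈ e.source, f x ∈ e'.source →
      ∃ g : PGL(Fin (n + 1), ℝ), ∀ᶠ y in 𝓝 x, e' (f y) = g • e y

theorem IsMorphism.comp {P : ProjectiveStructure n M} {f g : M → M} (hf : P.IsMorphism f)
    (hg : P.IsMorphism g) : P.IsMorphism (f ∘ g) := by
  refine ⟨hf.1.comp hg.1, fun e he e' he' x hx hx' => ?_⟩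
  obtain ⟨d, hd, hxd⟩ := P.cover (g x)
  obtain ⟨a, ha⟩ := hg.2 e he d hd x hx hxd
  obtain ⟨b, hb⟩ := hf.2 d hd e' he' (g x) hxd hx'
  refine ⟨b * a, ?_⟩
  filter_upwards [ha, hg.1.continuous.continuousAt.eventually hb] with y h1 h2
  rw [Function.comp_apply, h2, h1, mul_smul]

/-- The group of automorphisms of a projective structure: the bijective morphisms whose inverse is
a morphism. As a subgroup of `M ≃ₜ M` it carries the compact-open topology. -/
def aut (P : ProjectiveStructure n M) : Subgroup (M ≃ₜ M) where
  carrier := {f | P.IsMorphism f ∧ P.IsMorphism f.symm}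
  one_mem' := by
    have : P.IsMorphism (id : M → M) := ⟨contMDiff_id, P.compatible⟩
    exact ⟨this, this⟩
  mul_mem' hf hg := ⟨hf.1.comp hg.1, hg.2.comp hf.2⟩
  inv_mem' hf := ⟨hf.2, hf.1⟩

/-- `D : M' → ℝPⁿ` is a developing map over the (universal) covering `p : M' → M`: near every point
it is a chart of the lifted structure, that is, a chart of `M` composed with `p`, up to an element
of `PGL (n + 1, ℝ)`. -/
def IsDevelopingMap (P : ProjectiveStructure n M) {M' : Type*} [TopologicalSpace M']
    (p : M' → M) (D : M' → RealProj n) : Prop :=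
  ∀ z : M', ∀ e ∈ P.charts, p z ∈ e.source →
    ∃ g : PGL(Fin (n + 1), ℝ), ∀ᶠ w in 𝓝 z, D w = g • e (p w)

end ProjectiveStructure

/-! ### Real algebras with solvable unit group -/

section Algebra

open scoped commutatorElement

/-! The injective developing map identifies `M'` with an open set Ω of projective space, on which
the deck transformations act by matrices, the holonomy Γ. The proof shows that the centralizer Z of
Γ in GL(n+1, ℝ) controls the identity component of the automorphism group, and then finds a circle
in Z.

An automorphism near the identity lifts to a projective map g of Ω with matrix near 1. For a deck
transformation d, the commutator of g and d is again a deck transformation; it moves a base point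
only within its sheet, so it is the identity, and its matrix, scalar with determinant 1 and a
positive entry, is 1. Finitely many d suffice, because Z is the centralizer of a finite subset of Γ
(`Matrix.exists_finite_centralizer`). Hence an open subgroup of automorphisms is the image of a
group that embeds in Z (`eventually_mem_map_snd`, `isSolvable_centralizingLifts`), so Z is not
solvable.

Now Z embeds in the units of the algebra A of matrices commuting with Γ. If A had no nonzero X with
X³ = -X, then A modulo its radical would be a product of copies of ℝ, and its units would be
solvable (`isSolvable_units_of_cube`). So such an X exists, and exp(tX) is a circle commuting with
Γ.

By compactness of M and connectedness of the circle, this circle preserves Ω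
(`exists_smul_mem_range`). It therefore descends to M, where its action is nontrivial because its
matrices are not all scalar (`exists_circle_action`). -/

theorem eq_zero_of_isNilpotent_of_cube {B : Type*} [Ring B] {a : B} (h : a ^ 3 = -a)
    (hn : IsNilpotent a) : a = 0 := by
  obtain ⟨k, hk⟩ := hn
  -- Multiplication by a² negates a, so a is, up to sign, each of its odd powers.
  have key : ∀ m : ℕ, a = a ^ (2 * m + 1) * (-1) ^ m := by
    intro m
    induction m with
    | zero => simp
    | succ m ih =>
      have : a ^ (2 * (m + 1) + 1) = - a ^ (2 * m + 1) := by
        rw [show 2 * (m + 1) + 1 = 2 * m + 3 by ring, pow_add, h, pow_succ]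
        simp
      rw [this, pow_succ (-1 : B), neg_mul, mul_neg_one, mul_neg, neg_neg]
      exact ih
  rw [key k, pow_eq_zero_of_le (by omega) hk, zero_mul]

/-- Hensel lifting for T³ + T along a nil kernel: a preimage x differs by a nilpotent from an exact
root, which must be 0. So x is nilpotent, hence so is b, and b = 0. -/
theorem cube_eq_zero_of_surjective {A B : Type*} [Ring A] [Algebra ℝ A] [Ring B] [Algebra ℝ B]
    (f : A →ₐ[ℝ] B) (hf : Function.Surjective f) (hker : ∀ x, f x = 0 → IsNilpotent x)
    (h : ∀ x : A, x ^ 3 = -x → x = 0) (b : B) (hb : b ^ 3 = -b) : b = 0 := by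
  obtain ⟨x, rfl⟩ := hf b
  open Polynomial in
  let P : ℝ[X] := X ^ 3 + X
  set S := Algebra.adjoin ℝ {x}
  set y : S := ⟨x, Algebra.self_mem_adjoin_singleton ℝ x⟩
  have hPx : Polynomial.aeval y P = y ^ 3 + y := by simp [P]
  have hnil : IsNilpotent (Polynomial.aeval y P) := by
    obtain ⟨k, hk⟩ := hker (x ^ 3 + x) (by rw [map_add, map_pow, hb]; simp)
    refine ⟨k, Subtype.ext ?_⟩
    rw [hPx]
    simpa [y] using hk
  have hunit : IsUnit (Polynomial.aeval y (Polynomial.derivative P)) := by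
    have h1 : Polynomial.aeval y (Polynomial.derivative P) = 3 * y ^ 2 + 1 := by
      have : (algebraMap ℝ S) 2 + 1 = 3 := by rw [map_ofNat]; norm_num
      simp [P, this]
    -- A Bézout identity for T³ + T and its derivative: the derivative is invertible modulo the
    -- nilpotent y³ + y.
    have h2 : (3 * y ^ 2 + 1) * (1 + (3 / 2 : ℝ) • y ^ 2) =
        1 + (9 / 2 : ℝ) • y * (y ^ 3 + y) := by
      have e1 : (3 : S) * y ^ 2 = (3 : ℝ) • y ^ 2 := by
        rw [Algebra.smul_def, map_ofNat]
      rw [e1]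
      simp only [add_mul, mul_add, smul_mul_assoc, mul_smul_comm, one_mul, mul_one]
      rw [show y * y ^ 3 = y ^ 4 by ring, show y ^ 2 * y ^ 2 = y ^ 4 by ring,
        show y * y = y ^ 2 by ring]
      module
    have h3 : IsUnit (1 + (9 / 2 : ℝ) • y * (y ^ 3 + y)) := by
      rw [hPx] at hnil
      exact ((Commute.all _ _).isNilpotent_mul_left hnil).isUnit_one_add
    rw [h1]
    rw [← h2] at h3
    exact isUnit_of_mul_isUnit_left h3
  obtain ⟨r, ⟨hr1, hr2⟩, -⟩ :=
    Polynomial.existsUnique_nilpotent_sub_and_aeval_eq_zero hnil hunit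
  have hr3 : r ^ 3 + r = 0 := by simpa [P] using hr2
  have hr0 : (r : A) = 0 := by
    apply h
    rw [eq_neg_iff_add_eq_zero]
    simpa using congrArg Subtype.val hr3
  have hr : r = 0 := Subtype.ext hr0
  rw [hr, sub_zero] at hr1
  obtain ⟨k, hk⟩ := hr1
  apply eq_zero_of_isNilpotent_of_cube hb
  refine ⟨k, ?_⟩
  rw [← map_pow]
  have : x ^ k = 0 := by simpa [y] using congrArg Subtype.val hk
  rw [this, map_zero]

/-- Every element has degree at most 2 over ℝ, and a non-real one would yield, after an affine
change, a square root of -1. -/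
theorem exists_algebraMap_eq_of_cube {D : Type*} [DivisionRing D] [Algebra ℝ D]
    [FiniteDimensional ℝ D] (h : ∀ x : D, x ^ 3 = -x → x = 0) (x : D) :
    ∃ r : ℝ, algebraMap ℝ D r = x := by
  have hint : IsIntegral ℝ x := Algebra.IsIntegral.isIntegral x
  have hirr := minpoly.irreducible hint
  have hmon := minpoly.monic hint
  have hdeg : (minpoly ℝ x).degree ≤ 2 := hirr.degree_le_two
  by_contra hx
  have hx' : ∀ r : ℝ, x - algebraMap ℝ D r ≠ 0 := fun r hr => hx ⟨r, (sub_eq_zero.1 hr).symm⟩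
  obtain ⟨a, b, c, habc⟩ : ∃ a b c : ℝ, minpoly ℝ x =
      Polynomial.C a * Polynomial.X ^ 2 + Polynomial.C b * Polynomial.X + Polynomial.C c :=
    ⟨_, _, _, Polynomial.eq_quadratic_of_degree_le_two hdeg⟩
  have hroot : a • (x * x) + b • x + c • (1 : D) = 0 := by
    have := minpoly.aeval ℝ x
    rw [habc] at this
    simpa [Algebra.smul_def, pow_two] using this
  have ha : a ≠ 0 := by
    rintro rfl
    by_cases hb : b = 0
    · subst hb
      have hc : c = 0 := by simpa using hroot
      subst hc
      exact hmon.ne_zero (by simpa using habc)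
    · refine hx ⟨-(c / b), ?_⟩
      have : b • x = -(c • (1 : D)) := by
        rw [← add_eq_zero_iff_eq_neg]
        simpa using hroot
      rw [Algebra.algebraMap_eq_smul_one, ← inv_smul_smul₀ hb x, this, neg_smul, smul_neg,
        smul_smul, div_eq_inv_mul]
  -- Completing the square: w² is the discriminant. If it is nonnegative then w is real; if
  -- negative, a multiple of w squares to -1.
  set w : D := (2 * a) • x + b • (1 : D) with hw
  have hww : w * w = (b ^ 2 - 4 * a * c) • (1 : D) := by
    have : w * w = (4 * a) • (a • (x * x) + b • x + c • (1 : D)) + (b ^ 2 - 4 * a * c) • (1 : D) := by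
      simp only [hw, add_mul, mul_add, smul_mul_assoc, mul_smul_comm, one_mul, mul_one]
      module
    rw [this, hroot, smul_zero, zero_add]
  have hxw : ∀ s : ℝ, w ≠ s • (1 : D) := by
    intro s hs
    refine hx ⟨(2 * a)⁻¹ * (s - b), ?_⟩
    have h2a : 2 * a ≠ 0 := mul_ne_zero two_ne_zero ha
    have : (2 * a) • x = (s - b) • (1 : D) := by
      rw [sub_smul, ← hs, hw, add_sub_cancel_right]
    rw [Algebra.algebraMap_eq_smul_one, ← inv_smul_smul₀ h2a x, this, smul_smul]
  rcases le_or_gt 0 (b ^ 2 - 4 * a * c) with hs | hs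
  · obtain ⟨s, hs⟩ : ∃ s : ℝ, s * s = b ^ 2 - 4 * a * c := ⟨_, Real.mul_self_sqrt hs⟩
    have : (w - s • (1 : D)) * (w - (-s) • (1 : D)) = 0 := by
      simp only [sub_mul, mul_sub, smul_mul_assoc, mul_smul_comm, one_mul, mul_one, hww, ← hs]
      module
    rcases mul_eq_zero.1 this with h1 | h1
    · exact hxw _ (sub_eq_zero.1 h1)
    · exact hxw _ (sub_eq_zero.1 h1)
  · obtain ⟨s, hs'⟩ : ∃ s : ℝ, s * s = -(b ^ 2 - 4 * a * c) :=
      ⟨_, Real.mul_self_sqrt (by linarith)⟩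
    have hs0 : s ≠ 0 := by rintro rfl; linarith
    have hw0 : s⁻¹ • w = 0 := by
      apply h
      have h2 : s⁻¹ * (s⁻¹ * (b ^ 2 - 4 * a * c)) = -1 := by
        rw [← neg_eq_iff_eq_neg.2 hs']
        field_simp
      rw [pow_succ, pow_two, smul_mul_smul_comm, hww, smul_smul, mul_assoc, h2]
      simp
    rw [smul_eq_zero_iff_right (inv_ne_zero hs0)] at hw0
    exact hxw 0 (by rw [hw0, zero_smul])

/-- By Wedderburn–Artin the ring is a product of matrix rings over division algebras; the hypothesis
forces size at most one and division algebra ℝ. -/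
theorem mul_comm_of_cube {B : Type*} [Ring B] [Algebra ℝ B] [FiniteDimensional ℝ B]
    [IsSemisimpleRing B] (h : ∀ x : B, x ^ 3 = -x → x = 0) (x y : B) : x * y = y * x := by
  obtain ⟨n, D, d, _, _, _, hd, ⟨e⟩⟩ :=
    IsSemisimpleRing.exists_algEquiv_pi_matrix_divisionRing_finite ℝ B
  have h' : ∀ x : (Π i, Matrix (Fin (d i)) (Fin (d i)) (D i)), x ^ 3 = -x → x = 0 := by
    intro x hx
    have := h (e.symm x) (by rw [← map_pow, hx, map_neg])
    simpa using this
  have hM : ∀ i, ∀ x : Matrix (Fin (d i)) (Fin (d i)) (D i), x ^ 3 = -x → x = 0 := by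
    intro i x hx
    have := h' (Pi.single i x) (by
      rw [← Pi.single_neg, ← hx]
      ext j
      by_cases hj : j = i
      · subst hj; simp
      · simp [hj])
    simpa using this
  have hD : ∀ i, ∀ x : D i, x ^ 3 = -x → x = 0 := by
    intro i x hx
    have := hM i (Matrix.scalar _ x) (by rw [← map_pow, hx, map_neg])
    simpa using congrFun (congrFun this 0) 0
  have hsub : ∀ i, ∀ a b : Fin (d i), a = b := by
    intro i a b
    by_contra hab
    -- The infinitesimal rotation in the (a, b)-plane.
    have := hM i (Matrix.single a b 1 - Matrix.single b a 1) (by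
      simp [pow_succ, sub_mul, mul_sub, hab, Ne.symm hab, neg_add_eq_sub])
    have := congrFun (congrFun this a) b
    simp [hab, Ne.symm hab] at this
  apply e.injective
  rw [map_mul, map_mul]
  funext i
  ext a b
  have : Subsingleton (Fin (d i)) := ⟨hsub i⟩
  simp only [Pi.mul_apply, Matrix.mul_apply]
  refine Finset.sum_congr rfl fun c _ => ?_
  obtain rfl := hsub i c a
  obtain rfl := hsub i c b
  obtain ⟨r, hr⟩ := exists_algebraMap_eq_of_cube (hD i) (e x i c c)
  rw [← hr, Algebra.commutes]

/-- The derived series descends through the congruence subgroups 1 + Jᵐ, since uv - vu = (u-1)(v-1)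
- (v-1)(u-1) lies in a deeper power of J. -/
theorem isSolvable_units_of_isNilpotent {A : Type*} [Ring A] (J : Ideal A) [J.IsTwoSided]
    (hJ : IsNilpotent J) (hc : ∀ x y : A, x * y - y * x ∈ J) : Group.IsSolvable Aˣ := by
  have key : ∀ m : ℕ, ∀ u ∈ derivedSeries Aˣ (m + 1), (u : A) - 1 ∈ J ^ (m + 1) := by
    have hcomm : ∀ u v : Aˣ, ((⁅u, v⁆ : Aˣ) : A) - 1 =
        ((u : A) * v - v * u) * ((u⁻¹ : Aˣ) * (v⁻¹ : Aˣ)) := by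
      intro u v
      simp [commutatorElement_def, sub_mul, mul_assoc]
    let K (I : Ideal A) [I.IsTwoSided] : Subgroup Aˣ :=
      { carrier := {u | (u : A) - 1 ∈ I}
        one_mem' := by simp
        mul_mem' := by
          intro u v hu hv
          have : ((u * v : Aˣ) : A) - 1 = u * ((v : A) - 1) + ((u : A) - 1) := by
            push_cast; noncomm_ring
          show ((u * v : Aˣ) : A) - 1 ∈ I
          rw [this]
          exact add_mem (I.mul_mem_left _ hv) hu
        inv_mem' := by
          intro u hu
          have : ((u⁻¹ : Aˣ) : A) - 1 = - ((u⁻¹ : Aˣ) * ((u : A) - 1)) := by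
            simp [mul_sub]
          show ((u⁻¹ : Aˣ) : A) - 1 ∈ I
          rw [this]
          exact neg_mem (I.mul_mem_left _ hu) }
    intro m
    induction m with
    | zero =>
      have : derivedSeries Aˣ (0 + 1) ≤ K (J ^ (0 + 1)) := by
        rw [derivedSeries_succ, Subgroup.commutator_le]
        intro u _ v _
        show _ ∈ J ^ (0 + 1)
        rw [hcomm, zero_add, Submodule.pow_one]
        exact J.mul_mem_right _ (hc _ _)
      exact this
    | succ m ih =>
      have : derivedSeries Aˣ (m + 1 + 1) ≤ K (J ^ (m + 1 + 1)) := by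
        rw [derivedSeries_succ, Subgroup.commutator_le]
        intro u hu v hv
        show _ ∈ J ^ (m + 1 + 1)
        have h1 := ih u hu
        have h2 := ih v hv
        rw [hcomm]
        refine Ideal.mul_mem_right _ _ ?_
        have : (u : A) * v - v * u =
          ((u : A) - 1) * ((v : A) - 1) - ((v : A) - 1) * ((u : A) - 1) := by noncomm_ring
        rw [this]
        have hle : J ^ (m + 1) * J ^ (m + 1) ≤ J ^ (m + 1 + 1) := by
          rw [← Ideal.IsTwoSided.pow_add]
          exact Ideal.pow_le_pow_right (by omega)
        exact sub_mem (hle (Ideal.mul_mem_mul h1 h2)) (hle (Ideal.mul_mem_mul h2 h1))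
      exact this
  obtain ⟨k, hk⟩ := hJ
  refine ⟨k + 1, ?_⟩
  rw [eq_bot_iff]
  intro u hu
  have := key k u hu
  have h0 : (u : A) - 1 = 0 := by
    have h1 := Ideal.pow_le_pow_right (Nat.le_succ k) this
    rw [hk] at h1
    simpa using h1
  exact Units.ext (sub_eq_zero.1 h0)

/-- The unit group of a finite-dimensional real algebra is solvable unless the algebra contains
a nonzero element `x` with `x ^ 3 = -x`. -/
theorem isSolvable_units_of_cube {A : Type*} [Ring A] [Algebra ℝ A] [FiniteDimensional ℝ A]
    (h : ∀ x : A, x ^ 3 = -x → x = 0) : Group.IsSolvable Aˣ := by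
  have : IsArtinianRing A := IsArtinianRing.of_finite ℝ A
  have hn : IsNilpotent (Ring.jacobson A) := IsSemiprimaryRing.isNilpotent
  have : FiniteDimensional ℝ (A ⧸ Ring.jacobson A) :=
    Module.Finite.of_surjective (Ideal.Quotient.mkₐ ℝ (Ring.jacobson A)).toLinearMap
      Ideal.Quotient.mk_surjective
  have hB : ∀ b : A ⧸ Ring.jacobson A, b ^ 3 = -b → b = 0 :=
    cube_eq_zero_of_surjective (Ideal.Quotient.mkₐ ℝ (Ring.jacobson A))
      Ideal.Quotient.mk_surjective (by
        intro x hx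
        obtain ⟨k, hk⟩ := hn
        have hx' : x ∈ Ring.jacobson A := Ideal.Quotient.eq_zero_iff_mem.1 hx
        refine ⟨k, ?_⟩
        have := Ideal.pow_mem_pow hx' k
        rw [hk] at this
        simpa using this) h
  refine isSolvable_units_of_isNilpotent (Ring.jacobson A) hn fun x y => ?_
  rw [← Ideal.Quotient.eq_zero_iff_mem, map_sub, map_mul, map_mul, mul_comm_of_cube hB, sub_self]

end Algebra

/-! ### Projective frames and the smooth linear action -/

namespace RealProj

variable {n : ℕ}

theorem PGL_mk_smul (g : GL (Fin (n + 1)) ℝ) (x : RealProj n) :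
    (Matrix.ProjGenLinGroup.mk g : PGL(Fin (n + 1), ℝ)) • x = g • x := by
  induction x using Projectivization.ind with
  | h v hv => rfl

theorem mulVec_ne_zero (g : GL (Fin (n + 1)) ℝ) {v : Fin (n + 1) → ℝ} (hv : v ≠ 0) :
    g.1.mulVec v ≠ 0 :=
  (smul_ne_zero_iff_ne g).2 hv

theorem smul_mk (g : GL (Fin (n + 1)) ℝ) {v : Fin (n + 1) → ℝ} (hv : v ≠ 0) :
    g • (Projectivization.mk ℝ v hv : RealProj n) =
      Projectivization.mk ℝ (g.1.mulVec v) (mulVec_ne_zero g hv) := rfl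

/-- The nonzero vectors which represent the points of a set in projective space. -/
def cone (B : Set (RealProj n)) : Set (Fin (n + 1) → ℝ) :=
  {v | ∃ h : v ≠ 0, Projectivization.mk ℝ v h ∈ B}

theorem isOpen_cone {B : Set (RealProj n)} (hB : IsOpen B) : IsOpen (cone B) := by
  have h1 : IsOpen ((Projectivization.mk' ℝ : {v : Fin (n + 1) → ℝ // v ≠ 0} → RealProj n) ⁻¹' B) :=
    hB.preimage (isQuotientMap_mk n).continuous
  have h2 := isOpen_ne.isOpenMap_subtype_val _ h1
  convert! h2 using 1
  ext v
  simp [cone]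

theorem smul_mem_cone {B : Set (RealProj n)} {v : Fin (n + 1) → ℝ} (hv : v ∈ cone B) {c : ℝ}
    (hc : c ≠ 0) : c • v ∈ cone B := by
  obtain ⟨h0, hB⟩ := hv
  refine ⟨smul_ne_zero hc h0, ?_⟩
  convert! hB using 1
  rw [Projectivization.mk_eq_mk_iff']
  exact ⟨c, rfl⟩

/-- Every nonempty open set in projective space contains a projective frame. -/
theorem exists_frame {B : Set (RealProj n)} (hB : IsOpen B) (hne : B.Nonempty) :
    ∃ v : Fin (n + 1) → Fin (n + 1) → ℝ, LinearIndependent ℝ v ∧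
      (∀ i, v i ∈ cone B) ∧ ∑ i, v i ∈ cone B := by
  -- The sign of u is chosen so that the vectors u + ε eᵢ are independent for every ε > 0: their
  -- determinant is εⁿ(ε + Σ uₖ).
  obtain ⟨u, huB, hu⟩ : ∃ u ∈ cone B, 0 ≤ ∑ i, u i := by
    obtain ⟨x, hx⟩ := hne
    induction x using Projectivization.ind with
    | h v hv =>
      have hvB : v ∈ cone B := ⟨hv, hx⟩
      rcases le_total 0 (∑ i, v i) with h | h
      · exact ⟨v, hvB, h⟩
      · refine ⟨(-1 : ℝ) • v, smul_mem_cone hvB (by norm_num), ?_⟩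
        simpa using h
  have ho := isOpen_cone hB
  have key : ∀ a : Fin (n + 1) → ℝ, ∀ᶠ ε in 𝓝[>] (0 : ℝ), u + ε • a ∈ cone B := by
    intro a
    have hc : Filter.Tendsto (fun ε : ℝ => u + ε • a) (𝓝[>] 0) (𝓝 u) := by
      have : Continuous fun ε : ℝ => u + ε • a := by fun_prop
      simpa using (this.tendsto 0).mono_left nhdsWithin_le_nhds
    exact hc.eventually (ho.mem_nhds huB)
  have h1 : ∀ᶠ ε in 𝓝[>] (0 : ℝ), ∀ i, u + ε • (Pi.single i 1 : Fin (n + 1) → ℝ) ∈ cone B :=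
    Filter.eventually_all.2 fun i => key _
  have hn : ((n : ℝ) + 1) ≠ 0 := by positivity
  obtain ⟨ε, ⟨h1, h2⟩, h3⟩ := ((h1.and (key (((n : ℝ) + 1)⁻¹ • fun _ => 1))).and
    self_mem_nhdsWithin).exists
  have h3 : 0 < ε := h3
  refine ⟨fun i => u + ε • Pi.single i 1, ?_, h1, ?_⟩
  · rw [Fintype.linearIndependent_iff]
    intro c hc
    have hk : ∀ k, (∑ i, c i) * u k + ε * c k = 0 := by
      intro k
      have := congrFun hc k
      simp only [Finset.sum_apply, Pi.smul_apply, Pi.add_apply, smul_eq_mul, mul_add,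
        Finset.sum_add_distrib, Pi.zero_apply, ← Finset.sum_mul] at this
      rw [← this]
      simp [Pi.single_apply, mul_comm]
    have hs : (∑ i, c i) * ((∑ k, u k) + ε) = 0 := by
      have : ∑ k, ((∑ i, c i) * u k + ε * c k) = 0 := Finset.sum_eq_zero fun k _ => hk k
      rw [Finset.sum_add_distrib, ← Finset.mul_sum, ← Finset.mul_sum] at this
      linarith
    have hs0 : ∑ i, c i = 0 := by
      rcases mul_eq_zero.1 hs with h | h
      · exact h
      · linarith
    intro i
    have := hk i
    rw [hs0, zero_mul, zero_add] at this
    exact (mul_eq_zero.1 this).resolve_left h3.ne'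
  · convert! smul_mem_cone h2 hn using 1
    ext k
    simp [Finset.sum_add_distrib, Pi.single_apply]
    field_simp

theorem exists_smul_eq_mulVec {g : GL (Fin (n + 1)) ℝ} {v w : Fin (n + 1) → ℝ} (hv : v ≠ 0)
    (hw : w ≠ 0) (h : g • (Projectivization.mk ℝ v hv : RealProj n) = Projectivization.mk ℝ w hw) :
    ∃ c : ℝ, c ≠ 0 ∧ g.1.mulVec v = c • w := by
  rw [smul_mk, Projectivization.mk_eq_mk_iff] at h
  obtain ⟨a, ha⟩ := h
  exact ⟨a, a.ne_zero, ha.symm⟩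

/-- A linear map which fixes every point of a nonempty open set of projective space is a scalar. -/
theorem eq_smul_one_of_smul_eq {B : Set (RealProj n)} (hB : IsOpen B) (hne : B.Nonempty)
    (g : GL (Fin (n + 1)) ℝ) (hg : ∀ x ∈ B, g • x = x) :
    ∃ c : ℝ, c ≠ 0 ∧ (g : Matrix (Fin (n + 1)) (Fin (n + 1)) ℝ) = c • 1 := by
  obtain ⟨v, hli, hv, hs⟩ := exists_frame hB hne
  have h1 : ∀ w ∈ cone B, ∃ c : ℝ, c ≠ 0 ∧ g.1.mulVec w = c • w := by
    rintro w ⟨h0, hw⟩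
    exact exists_smul_eq_mulVec h0 h0 (hg _ hw)
  choose c hc0 hc using fun i => h1 _ (hv i)
  obtain ⟨d, hd0, hd⟩ := h1 _ hs
  -- The sum of the frame vectors is an eigenvector too, which forces all eigenvalues to agree.
  have hcd : ∀ i, c i = d := by
    have : ∑ i, (c i - d) • v i = 0 := by
      simp only [sub_smul, Finset.sum_sub_distrib, ← hc, ← Finset.smul_sum, ← hd]
      rw [Matrix.mulVec_sum, sub_self]
    intro i
    exact sub_eq_zero.1 (Fintype.linearIndependent_iff.1 hli _ this i)
  refine ⟨d, hd0, ?_⟩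
  let b := basisOfLinearIndependentOfCardEqFinrank hli (by simp)
  apply Matrix.toLin'.injective
  apply b.ext
  intro i
  simp [b, hc, hcd]

/-- A projective map fixing an open set pointwise is trivial. This rigidity is what allows local
projective expressions to be glued. -/
theorem PGL_eq_of_smul_eq {B : Set (RealProj n)} (hB : IsOpen B) (hne : B.Nonempty)
    (g h : PGL(Fin (n + 1), ℝ)) (hg : ∀ x ∈ B, g • x = h • x) : g = h := by
  obtain ⟨k, hk⟩ := Matrix.ProjGenLinGroup.mk_surjective (h⁻¹ * g)
  suffices h⁻¹ * g = 1 from (inv_mul_eq_one.1 this).symm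
  obtain ⟨c, hc0, hc⟩ := eq_smul_one_of_smul_eq hB hne k (fun x hx => by
    rw [← PGL_mk_smul, hk, mul_smul, hg x hx, inv_smul_smul])
  rw [← hk, ← Matrix.ProjGenLinGroup.mk_one, Matrix.ProjGenLinGroup.mk_eq_mk_iff]
  refine ⟨(Units.mk0 c hc0)⁻¹, ?_⟩
  apply Units.ext
  rw [Units.val_mul, hc, Matrix.GeneralLinearGroup.coe_scalar, Matrix.scalar_apply,
    ← Matrix.smul_one_eq_diagonal]
  simp [smul_smul, hc0]

/-- The representative of a point of projective space whose `i`-th coordinate is one. -/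
noncomputable def affineLift (i : Fin (n + 1)) (x : RealProj n) : Fin (n + 1) → ℝ :=
  i.insertNth (1 : ℝ) (affineCoord i x : Fin n → ℝ)

theorem affineLift_ne_zero (i : Fin (n + 1)) (x : RealProj n) : affineLift i x ≠ 0 :=
  insertNth_ne_zero i _

theorem mk_affineLift {i : Fin (n + 1)} {x : RealProj n} (hx : x ∈ affineSet i) :
    Projectivization.mk ℝ (affineLift i x) (affineLift_ne_zero i x) = x :=
  (affineChart i).left_inv hx

theorem affineLift_mk {i : Fin (n + 1)} {v : Fin (n + 1) → ℝ} (hv : v ≠ 0) (hi : v i ≠ 0) :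
    v i • affineLift i (Projectivization.mk ℝ v hv) = v := by
  funext k
  rcases Fin.eq_self_or_eq_succAbove i k with rfl | ⟨j, rfl⟩
  · simp [affineLift]
  · simp [affineLift, mul_div_cancel₀ _ hi]

theorem affineChart_mem_maximalAtlas (i : Fin (n + 1)) :
    affineChart i ∈ IsManifold.maximalAtlas (𝓡 n) ∞ (RealProj n) :=
  IsManifold.subset_maximalAtlas (Set.mem_range_self i)

theorem contMDiffAt_affineLift {i : Fin (n + 1)} {x : RealProj n} (hx : x ∈ affineSet i) :
    ContMDiffAt (𝓡 n) 𝓘(ℝ, Fin (n + 1) → ℝ) ∞ (affineLift i) x := by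
  have h1 : ContMDiffAt (𝓡 n) (𝓡 n) ∞ (affineChart i) x :=
    (contMDiffOn_of_mem_maximalAtlas (affineChart_mem_maximalAtlas i)).contMDiffAt
      ((affineChart i).open_source.mem_nhds hx)
  have h2 : ContDiff ℝ ∞ fun y : EuclideanSpace ℝ (Fin n) =>
      (i.insertNth (1 : ℝ) (y : Fin n → ℝ) : Fin (n + 1) → ℝ) := by
    rw [contDiff_pi]
    intro k
    rcases Fin.eq_self_or_eq_succAbove i k with rfl | ⟨j, rfl⟩
    · simpa using contDiff_const
    · simp only [Fin.insertNth_apply_succAbove]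
      fun_prop
  exact h2.contMDiff.contMDiffAt.comp x h1

section Smooth

variable {E H N : Type*} [NormedAddCommGroup E] [NormedSpace ℝ E] [TopologicalSpace H]
  {I : ModelWithCorners ℝ E H} [TopologicalSpace N] [ChartedSpace H N]

theorem contMDiffAt_mk {w : N → Fin (n + 1) → ℝ} (h0 : ∀ q, w q ≠ 0) {q : N}
    (hw : ContMDiffAt I 𝓘(ℝ, Fin (n + 1) → ℝ) ∞ w q) :
    ContMDiffAt I (𝓡 n) ∞ (fun q => (Projectivization.mk ℝ (w q) (h0 q) : RealProj n)) q := by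
  obtain ⟨j, hj⟩ := Function.ne_iff.1 (h0 q)
  have hwk : ∀ k, ContMDiffAt I 𝓘(ℝ, ℝ) ∞ (fun q => w q k) q := contMDiffAt_pi_space.1 hw
  have hj' : ∀ᶠ r in 𝓝 q, w r j ≠ 0 := (hwk j).continuousAt.eventually_ne hj
  have h1 : ContMDiffAt I (𝓡 n) ∞ (fun r => (WithLp.toLp 2 fun k => w r (j.succAbove k) / w r j :
      EuclideanSpace ℝ (Fin n))) q := by
    have h2 : ContMDiffAt I 𝓘(ℝ, Fin n → ℝ) ∞ (fun r => fun k => w r (j.succAbove k) / w r j) q :=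
      contMDiffAt_pi_space.2 fun k => (hwk _).div₀ (hwk j) hj
    exact (PiLp.contDiff_toLp (p := 2)).contMDiff.contMDiffAt.comp q h2
  have h3 : ContMDiff (𝓡 n) (𝓡 n) ∞ (affineChart (n := n) j).symm := by
    rw [← contMDiffOn_univ]
    exact contMDiffOn_symm_of_mem_maximalAtlas (affineChart_mem_maximalAtlas j)
  refine (h3.contMDiffAt.comp q h1).congr_of_eventuallyEq ?_
  filter_upwards [hj'] with r hr
  exact ((affineChart j).left_inv (x := Projectivization.mk ℝ (w r) (h0 r)) hr).symm

/-- The action of the general linear group on projective space is smooth. -/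
theorem contMDiff_gl_smul {B : N → GL (Fin (n + 1)) ℝ}
    (hB : ∀ i j, ContMDiff I 𝓘(ℝ, ℝ) ∞ fun q => (B q).1 i j) :
    ContMDiff (I.prod (𝓡 n)) (𝓡 n) ∞ (fun q : N × RealProj n => B q.1 • q.2) := by
  rintro ⟨q, x⟩
  obtain ⟨i, hi⟩ := exists_mem_affineSet x
  have h1 : ContMDiffAt (I.prod (𝓡 n)) 𝓘(ℝ, Fin (n + 1) → ℝ) ∞
      (fun r : N × RealProj n => affineLift i r.2) (q, x) :=
    ContMDiffAt.comp (q, x) (g := affineLift i) (contMDiffAt_affineLift hi) contMDiffAt_snd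
  have h2 : ContMDiffAt (I.prod (𝓡 n)) 𝓘(ℝ, Fin (n + 1) → ℝ) ∞
      (fun r : N × RealProj n => (B r.1).1.mulVec (affineLift i r.2)) (q, x) := by
    refine contMDiffAt_pi_space.2 fun k => ?_
    simp only [Matrix.mulVec, dotProduct]
    refine contMDiffAt_finsetSum fun j _ => ?_
    exact (((hB k j).contMDiffAt).comp (q, x) contMDiffAt_fst).mul (contMDiffAt_pi_space.1 h1 j)
  refine (contMDiffAt_mk (fun r => mulVec_ne_zero _ (affineLift_ne_zero i r.2))
    h2).congr_of_eventuallyEq ?_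
  have : ∀ᶠ r : N × RealProj n in 𝓝 (q, x), r.2 ∈ affineSet i :=
    continuous_snd.continuousAt.eventually ((isOpen_affineSet i).mem_nhds hi)
  filter_upwards [this] with r hr
  conv_lhs => rw [← mk_affineLift hr]
  rfl

end Smooth

theorem contMDiff_const_smul (g : GL (Fin (n + 1)) ℝ) :
    ContMDiff (𝓡 n) (𝓡 n) ∞ (fun x : RealProj n => g • x) :=
  (contMDiff_gl_smul (I := 𝓡 n) (B := fun _ : RealProj n => g) fun _ _ => contMDiff_const).comp
    (contMDiff_id.prodMk contMDiff_id)

theorem contMDiff_PGL_smul (g : PGL(Fin (n + 1), ℝ)) :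
    ContMDiff (𝓡 n) (𝓡 n) ∞ (fun x : RealProj n => g • x) := by
  obtain ⟨k, rfl⟩ := Matrix.ProjGenLinGroup.mk_surjective g
  simpa only [PGL_mk_smul] using contMDiff_const_smul k

instance : ContinuousConstSMul PGL(Fin (n + 1), ℝ) (RealProj n) :=
  ⟨fun g => (contMDiff_PGL_smul g).continuous⟩

/-- Near a nonzero vector, projective space has a continuous section through that vector. -/
theorem exists_section {v : Fin (n + 1) → ℝ} (hv : v ≠ 0) :
    ∃ s : RealProj n → Fin (n + 1) → ℝ, ContinuousAt s (Projectivization.mk ℝ v hv) ∧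
      s (Projectivization.mk ℝ v hv) = v ∧
      ∀ᶠ y in 𝓝 (Projectivization.mk ℝ v hv : RealProj n),
        ∃ h : s y ≠ 0, Projectivization.mk ℝ (s y) h = y := by
  obtain ⟨i, hi⟩ := Function.ne_iff.1 hv
  have hx : (Projectivization.mk ℝ v hv : RealProj n) ∈ affineSet i := hi
  refine ⟨fun y => v i • affineLift i y, ?_, affineLift_mk hv hi, ?_⟩
  · exact ContinuousAt.const_smul (contMDiffAt_affineLift hx).continuousAt (v i)
  · filter_upwards [(isOpen_affineSet i).mem_nhds hx] with y hy
    refine ⟨smul_ne_zero hi (affineLift_ne_zero i y), ?_⟩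
    conv_rhs => rw [← mk_affineLift hy]
    rw [Projectivization.mk_eq_mk_iff']
    exact ⟨v i, rfl⟩

/-- A projective transformation which moves the points of a projective frame only a little has a
matrix which is close to the identity. -/
theorem eventually_exists_smul_mem {v : Fin (n + 1) → Fin (n + 1) → ℝ}
    (hli : LinearIndependent ℝ v) (hv : ∀ i, v i ≠ 0) (hs : ∑ i, v i ≠ 0)
    {V : Set (Matrix (Fin (n + 1)) (Fin (n + 1)) ℝ)} (hV : V ∈ 𝓝 1) :
    ∀ᶠ y : (Fin (n + 1) → RealProj n) × RealProj n in
      𝓝 (fun i => Projectivization.mk ℝ (v i) (hv i), Projectivization.mk ℝ (∑ i, v i) hs),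
      ∀ g : GL (Fin (n + 1)) ℝ, (∀ i, g • Projectivization.mk ℝ (v i) (hv i) = y.1 i) →
        g • (Projectivization.mk ℝ (∑ i, v i) hs : RealProj n) = y.2 →
        ∃ c : ℝ, c ≠ 0 ∧ c • g.1 ∈ V := by
  choose s hsc hsv hsm using fun i => exists_section (hv i)
  obtain ⟨t, htc, htv, htm⟩ := exists_section hs
  set y₀ : (Fin (n + 1) → RealProj n) × RealProj n :=
    (fun i => Projectivization.mk ℝ (v i) (hv i), Projectivization.mk ℝ (∑ i, v i) hs) with hy₀
  set P : Matrix (Fin (n + 1)) (Fin (n + 1)) ℝ := Matrix.of fun k i => v i k with hP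
  have hPdet : P.det ≠ 0 := by
    rw [← Matrix.det_transpose]
    have : IsUnit P.transpose := Matrix.linearIndependent_rows_iff_isUnit.1 hli
    exact ((Matrix.isUnit_iff_isUnit_det _).1 this).ne_zero
  have hsum : P.mulVec 1 = ∑ i, v i := by
    ext k
    simp [hP, Matrix.mulVec, dotProduct]
  -- The columns of `W y` represent the images of the frame points, continuously near `y₀`.
  let W : (Fin (n + 1) → RealProj n) × RealProj n → Matrix (Fin (n + 1)) (Fin (n + 1)) ℝ :=
    fun y => Matrix.of fun k i => s i (y.1 i) k
  have hWc : ContinuousAt W y₀ := by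
    refine continuousAt_pi.2 fun k => continuousAt_pi.2 fun i => ?_
    have h1 : ContinuousAt (fun y : (Fin (n + 1) → RealProj n) × RealProj n => y.1 i) y₀ := by
      fun_prop
    have h2 : ContinuousAt (fun x => s i x k) (y₀.1 i) :=
      (continuous_apply k).continuousAt.comp (hsc i)
    exact ContinuousAt.comp (g := fun x => s i x k) h2 h1
  have hW₀ : W y₀ = P := by
    ext k i
    simp [W, hP, hy₀, hsv]
  have hWdet : ContinuousAt (fun y => (W y).det) y₀ :=
    (continuous_id.matrix_det).continuousAt.comp hWc
  have hWne : ∀ᶠ y in 𝓝 y₀, (W y).det ≠ 0 :=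
    hWdet.eventually_ne (by rwa [hW₀])
  -- Cramer's rule for W λ = t, with t representing the image of the unit point; λ gives the correct
  -- scaling of the columns.
  let lam : (Fin (n + 1) → RealProj n) × RealProj n → Fin (n + 1) → ℝ :=
    fun y => (W y).det⁻¹ • (W y).adjugate.mulVec (t y.2)
  have hinv : ∀ {Q : Matrix (Fin (n + 1)) (Fin (n + 1)) ℝ}, Q.det ≠ 0 → ∀ u,
      Q.det⁻¹ • Q.adjugate.mulVec (Q.mulVec u) = u := by
    intro Q hQ u
    rw [Matrix.mulVec_mulVec, Matrix.adjugate_mul, Matrix.smul_mulVec, Matrix.one_mulVec, smul_smul,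
      inv_mul_cancel₀ hQ, one_smul]
  have htc' : ContinuousAt (fun y : (Fin (n + 1) → RealProj n) × RealProj n => t y.2) y₀ :=
    ContinuousAt.comp (g := t) htc continuousAt_snd
  have hlamc : ContinuousAt lam y₀ := by
    refine (hWdet.inv₀ (by rwa [hW₀])).smul ?_
    have h1 : ContinuousAt (fun y => (W y).adjugate) y₀ :=
      (continuous_id.matrix_adjugate).continuousAt.comp hWc
    have h2 : Continuous fun q : Matrix (Fin (n + 1)) (Fin (n + 1)) ℝ × (Fin (n + 1) → ℝ) =>
        q.1.mulVec q.2 := continuous_fst.matrix_mulVec continuous_snd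
    exact ContinuousAt.comp (f := fun y => ((W y).adjugate, t y.2)) h2.continuousAt
      (h1.prodMk htc')
  have hlam₀ : lam y₀ = 1 := by
    have : t y₀.2 = P.mulVec 1 := by rw [hsum, ← htv]
    simp only [lam, hW₀, this, hinv hPdet]
  -- The matrix recovered from the images of the frame; every g with these images is a multiple of
  -- it.
  let Φ : (Fin (n + 1) → RealProj n) × RealProj n → Matrix (Fin (n + 1)) (Fin (n + 1)) ℝ :=
    fun y => W y * Matrix.diagonal (lam y) * P⁻¹
  have hΦc : ContinuousAt Φ y₀ := by
    have h2 : Continuous fun q : Matrix (Fin (n + 1)) (Fin (n + 1)) ℝ × (Fin (n + 1) → ℝ) =>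
        q.1 * Matrix.diagonal q.2 * P⁻¹ :=
      (continuous_fst.matrix_mul continuous_snd.matrix_diagonal).matrix_mul continuous_const
    exact ContinuousAt.comp (f := fun y => (W y, lam y)) h2.continuousAt (hWc.prodMk hlamc)
  have hΦ₀ : Φ y₀ = 1 := by
    simp only [Φ, hW₀, hlam₀]
    rw [show Matrix.diagonal (1 : Fin (n + 1) → ℝ) = 1 from Matrix.diagonal_one, mul_one,
      Matrix.mul_nonsing_inv _ (isUnit_iff_ne_zero.2 hPdet)]
  have hsm' : ∀ᶠ y in 𝓝 y₀, ∀ i, ∃ h : s i (y.1 i) ≠ 0,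
      Projectivization.mk ℝ (s i (y.1 i)) h = y.1 i := by
    refine Filter.eventually_all.2 fun i => ?_
    have h1 : ContinuousAt (fun y : (Fin (n + 1) → RealProj n) × RealProj n => y.1 i) y₀ := by
      fun_prop
    exact h1.eventually (hsm i)
  have htm' : ∀ᶠ y in 𝓝 y₀, ∃ h : t y.2 ≠ 0, Projectivization.mk ℝ (t y.2) h = y.2 :=
    (continuous_snd.tendsto y₀).eventually htm
  have hΦV : ∀ᶠ y in 𝓝 y₀, Φ y ∈ V := hΦc.eventually (by rwa [hΦ₀])
  filter_upwards [hWne, hsm', htm', hΦV] with y h1 h2 h3 h4 g hg hg'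
  choose h2 h2' using h2
  obtain ⟨h3, h3'⟩ := h3
  choose c hc0 hc using fun i => exists_smul_eq_mulVec (hv i) (h2 i) ((hg i).trans (h2' i).symm)
  obtain ⟨d, hd0, hd⟩ := exists_smul_eq_mulVec hs h3 (hg'.trans h3'.symm)
  have hGP : g.1 * P = W y * Matrix.diagonal c := by
    ext k i
    rw [Matrix.mul_diagonal]
    have := congrFun (hc i) k
    simp only [Pi.smul_apply, smul_eq_mul] at this
    rw [mul_comm] at this
    exact this
  have hWcd : (W y).mulVec c = d • t y.2 := by
    rw [← hd, ← hsum, Matrix.mulVec_mulVec, hGP, ← Matrix.mulVec_mulVec]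
    congr 1
    ext k
    simp [Matrix.mulVec_diagonal]
  have hcl : c = d • lam y := by
    have := hinv h1 c
    rw [hWcd, Matrix.mulVec_smul, smul_comm] at this
    exact this.symm
  refine ⟨d⁻¹, inv_ne_zero hd0, ?_⟩
  have : d⁻¹ • g.1 = Φ y := by
    have h5 : g.1 = g.1 * P * P⁻¹ := by
      rw [mul_assoc, Matrix.mul_nonsing_inv _ (isUnit_iff_ne_zero.2 hPdet), mul_one]
    rw [h5, hGP, hcl]
    have : Matrix.diagonal (d • lam y) = d • Matrix.diagonal (lam y) := by
      ext i j
      simp [Matrix.diagonal_apply]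
    rw [this, Matrix.mul_smul, Matrix.smul_mul, smul_smul, inv_mul_cancel₀ hd0, one_smul]
  rwa [this]

end RealProj

/-! ### Centralizers of matrices and their circle subgroups -/

section Centralizer

variable {ι : Type*} [Fintype ι] [DecidableEq ι]

/-- If the centralizer of a set of invertible real matrices is not solvable, then some nonzero
matrix `X` with `X ^ 3 = -X` commutes with the set. -/
theorem Matrix.exists_cube_eq_neg_of_not_isSolvable_centralizer {S : Set (GL ι ℝ)}
    (hS : ¬ Group.IsSolvable (Subgroup.centralizer S)) :
    ∃ X : Matrix ι ι ℝ, X ≠ 0 ∧ X ^ 3 = -X ∧ ∀ g ∈ S, X * g.1 = g.1 * X := by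
  by_contra! hcon
  apply hS
  let A : Subalgebra ℝ (Matrix ι ι ℝ) := Subalgebra.centralizer ℝ (Units.val '' S)
  have hA : ∀ g ∈ Subgroup.centralizer S, (g : GL ι ℝ).1 ∈ A := by
    rintro g hg _ ⟨s, hs, rfl⟩
    exact congrArg Units.val (Subgroup.mem_centralizer_iff.1 hg s hs)
  have : Group.IsSolvable Aˣ := by
    apply isSolvable_units_of_cube
    intro x hx
    by_contra hx0
    obtain ⟨g, hg, hne⟩ := hcon x.1 (fun h => hx0 (Subtype.ext h))
      (by simpa using congrArg Subtype.val hx)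
    exact hne (x.2 g.1 ⟨g, hg, rfl⟩).symm
  let f : Subgroup.centralizer S →* A :=
    { toFun := fun g => ⟨g.1.1, hA _ g.2⟩
      map_one' := rfl
      map_mul' := fun _ _ => rfl }
  refine Group.isSolvable_of_isSolvable_injective (f := f.toHomUnits) fun a b hab => ?_
  have h1 : f a = f b := congrArg Units.val hab
  exact Subtype.ext (Units.ext (congrArg Subtype.val h1))

/-- The centralizer of a set of real matrices is the centralizer of a finite subset. -/
theorem Matrix.exists_finite_centralizer (S : Set (GL ι ℝ)) :
    ∃ S₀ ⊆ S, S₀.Finite ∧ ∀ g : GL ι ℝ, (∀ s ∈ S₀, s * g = g * s) → g ∈ Subgroup.centralizer S := by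
  let C : Set (GL ι ℝ) → Subalgebra ℝ (Matrix ι ι ℝ) :=
    fun T => Subalgebra.centralizer ℝ (Units.val '' T)
  have hwf : WellFounded ((· < ·) : Submodule ℝ (Matrix ι ι ℝ) → _ → Prop) := wellFounded_lt
  let F : Set (Submodule ℝ (Matrix ι ι ℝ)) :=
    {N | ∃ T ⊆ S, T.Finite ∧ N = (C T).toSubmodule}
  have hne : F.Nonempty := ⟨_, ∅, Set.empty_subset _, Set.finite_empty, rfl⟩
  -- Take a finite subset with minimal commutant; adding one more element cannot shrink it.
  obtain ⟨T, hT, hfin, hmin⟩ := hwf.min_mem F hne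
  refine ⟨T, hT, hfin, fun g hg => Subgroup.mem_centralizer_iff.2 fun s hs => ?_⟩
  have hle : (C (insert s T)).toSubmodule ≤ (C T).toSubmodule := by
    rintro x hx _ ⟨t, ht, rfl⟩
    exact hx _ ⟨t, Set.mem_insert_of_mem _ ht, rfl⟩
  have hnlt : ¬ (C (insert s T)).toSubmodule < (C T).toSubmodule := by
    rw [← hmin]
    exact hwf.not_lt_min F ⟨_, Set.insert_subset hs hT, hfin.insert s, rfl⟩
  have heq : (C (insert s T)).toSubmodule = (C T).toSubmodule :=
    hle.eq_of_not_lt hnlt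
  have hgT : g.1 ∈ (C T).toSubmodule := by
    rintro _ ⟨t, ht, rfl⟩
    exact congrArg Units.val (hg t ht)
  rw [← heq] at hgT
  exact Units.ext (hgT s.1 ⟨s, Set.mem_insert _ _, rfl⟩)

/-- The rotations generated by a matrix `X` with `X ^ 3 = -X`. -/
noncomputable def Matrix.rotation {X : Matrix ι ι ℝ} (hX : X ^ 3 = -X) : Circle →* GL ι ℝ :=
  MonoidHom.toHomUnits
    -- This is exp(tX) at z = exp(it): X³ = -X folds the series into 1 + sin t · X + (1 - cos t) ·
    -- X².
    { toFun := fun z => 1 + (z : ℂ).im • X + (1 - (z : ℂ).re) • X ^ 2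
      map_one' := by simp
      map_mul' := fun z w => by
        have h3 : X ^ 2 * X = -X := by rw [← hX]; rfl
        have h3' : X * X ^ 2 = -X := by rw [← hX, ← pow_succ']
        have h4 : X ^ 2 * X ^ 2 = -X ^ 2 := by
          rw [show X ^ 2 * X ^ 2 = X ^ 2 * X * X by rw [mul_assoc, ← pow_two X], h3, neg_mul,
            ← pow_two X]
        simp only [Circle.coe_mul, Complex.mul_im, Complex.mul_re, add_mul, mul_add,
          smul_mul_assoc, mul_smul_comm, one_mul, mul_one, h3, h3', h4, ← pow_two X]
        module }

theorem Matrix.coe_rotation {X : Matrix ι ι ℝ} (hX : X ^ 3 = -X) (z : Circle) :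
    (Matrix.rotation hX z).1 = 1 + (z : ℂ).im • X + (1 - (z : ℂ).re) • X ^ 2 := rfl

theorem Matrix.contMDiff_rotation {X : Matrix ι ι ℝ} (hX : X ^ 3 = -X) (i j : ι) :
    ContMDiff (𝓡 1) 𝓘(ℝ, ℝ) ∞ fun z => (Matrix.rotation hX z).1 i j := by
  have hF : Fact (Module.finrank ℝ ℂ = 1 + 1) := ⟨Complex.finrank_real_complex⟩
  have hc : ContMDiff (𝓡 1) 𝓘(ℝ, ℂ) ∞ fun z : Circle => (z : ℂ) :=
    contMDiff_coe_sphere (E := ℂ) (n := 1)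
  have hd : ContDiff ℝ ∞ fun z : ℂ =>
      (1 + z.im • X + (1 - z.re) • X ^ 2 : Matrix ι ι ℝ) i j := by
    simp only [Matrix.add_apply, Matrix.smul_apply, smul_eq_mul]
    have h1 : ContDiff ℝ ∞ fun z : ℂ => z.im := Complex.imCLM.contDiff
    have h2 : ContDiff ℝ ∞ fun z : ℂ => z.re := Complex.reCLM.contDiff
    fun_prop
  exact hd.contMDiff.comp hc

theorem Matrix.rotation_commute {X : Matrix ι ι ℝ} (hX : X ^ 3 = -X) {g : GL ι ℝ}
    (hg : X * g.1 = g.1 * X) (z : Circle) :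
    g * Matrix.rotation hX z = Matrix.rotation hX z * g := by
  apply Units.ext
  have h2 : X ^ 2 * g.1 = g.1 * X ^ 2 := (Commute.pow_left (show Commute X g.1 from hg) 2)
  simp only [Units.val_mul, coe_rotation, mul_add, add_mul, mul_smul_comm, smul_mul_assoc, hg, h2,
    mul_one, one_mul]

/-- Were the rotations at i and -i both scalar, their difference 2X would be too; but a real a with
a³ = -a is 0. -/
theorem Matrix.exists_rotation_ne_smul_one {X : Matrix ι ι ℝ} (hX : X ^ 3 = -X) (h0 : X ≠ 0) :
    ∃ z : Circle, ∀ c : ℝ, (Matrix.rotation hX z).1 ≠ c • 1 := by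
  by_contra! hcon
  let z : Circle := ⟨Complex.I, by simp [Submonoid.unitSphere]⟩
  obtain ⟨c, hc⟩ := hcon z
  obtain ⟨d, hd⟩ := hcon z⁻¹
  have hz : (z : ℂ) = Complex.I := rfl
  have h1 : 1 + X + X ^ 2 = c • 1 := by
    rw [coe_rotation, hz] at hc
    simpa using hc
  have h2 : 1 - X + X ^ 2 = d • 1 := by
    rw [coe_rotation, Circle.coe_inv_eq_conj, hz] at hd
    simpa [← sub_eq_add_neg] using hd
  have h3 : X = ((c - d) / 2) • 1 := by
    have : (2 : ℝ) • X = (c - d) • 1 := by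
      rw [sub_smul, ← h1, ← h2]
      module
    rw [div_eq_inv_mul, mul_smul, ← this, smul_smul]
    norm_num
  set a := (c - d) / 2
  rw [h3] at hX h0
  have h4 : (a ^ 3 + a) • (1 : Matrix ι ι ℝ) = 0 := by
    rw [add_smul, ← add_eq_zero_iff_eq_neg.2 hX, smul_pow, one_pow]
  have h1' : (1 : Matrix ι ι ℝ) ≠ 0 := fun h => h0 (by rw [h, smul_zero])
  have h5 := (smul_eq_zero.1 h4).resolve_right h1'
  have h6 : a * (a ^ 2 + 1) = 0 := by linarith
  rcases mul_eq_zero.1 h6 with h | h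
  · exact h0 (by rw [h, zero_smul])
  · nlinarith [sq_nonneg a]

end Centralizer

/-! ### Lifting maps to the universal covering -/

namespace IsCoveringMap

variable {M M' : Type*} [TopologicalSpace M] [TopologicalSpace M'] {p : M' → M}

theorem surjective_of_pathConnectedSpace [Nonempty M'] [PathConnectedSpace M]
    (hp : IsCoveringMap p) : Function.Surjective p := by
  intro m
  obtain ⟨z⟩ := ‹Nonempty M'›
  let γ := PathConnectedSpace.somePath (p z) m
  obtain ⟨Γ, hΓ, -⟩ := hp.exists_path_lifts γ z γ.source
  exact ⟨Γ 1, (congrFun hΓ 1).trans γ.target⟩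

variable [SimplyConnectedSpace M'] [LocallyPathConnectedSpace M']

/-- A continuous map of the base lifts to the universal covering. -/
theorem exists_lift (hp : IsCoveringMap p) {f : M → M} (hf : Continuous f) {z w : M'}
    (h : p w = f (p z)) :
    ∃ F : M' → M', Continuous F ∧ (∀ x, p (F x) = f (p x)) ∧ F z = w := by
  obtain ⟨F, ⟨hF1, hF2⟩, -⟩ :=
    hp.existsUnique_continuousMap_lifts ⟨fun x => f (p x), hf.comp hp.continuous⟩ z w h
  exact ⟨F, F.continuous, fun x => congrFun hF2 x, hF1⟩

/-- The lift of `f'` is normalised at one point; both composites then lift the identity and fix a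
point, so they are the identity. -/
theorem exists_inverse_lift (hp : IsCoveringMap p) {f f' : M → M} (hf' : Continuous f')
    (h1 : ∀ x, f (f' x) = x) (h2 : ∀ x, f' (f x) = x) [Nonempty M'] {F : M' → M'}
    (hF : Continuous F) (hFp : ∀ x, p (F x) = f (p x)) :
    ∃ F' : M' → M', Continuous F' ∧ (∀ x, p (F' x) = f' (p x)) ∧ (∀ x, F (F' x) = x) ∧
      ∀ x, F' (F x) = x := by
  obtain ⟨z⟩ := ‹Nonempty M'›
  obtain ⟨F', hF', hFp', hz⟩ := hp.exists_lift hf' (z := F z) (w := z) (by rw [hFp, h2])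
  refine ⟨F', hF', hFp', ?_, ?_⟩
  · refine congrFun (hp.eq_of_comp_eq (hF.comp hF') continuous_id ?_ (F z) (by simp [hz]))
    funext x
    simp [hFp, hFp', h1]
  · refine congrFun (hp.eq_of_comp_eq (hF'.comp hF) continuous_id ?_ z (by simp [hz]))
    funext x
    simp [hFp, hFp', h2]

end IsCoveringMap

/-! ### Developing maps and holonomy -/

namespace ProjectiveStructure

variable {n : ℕ} {M : Type*} [TopologicalSpace M] [ChartedSpace (EuclideanSpace ℝ (Fin n)) M]
  {P : ProjectiveStructure n M} {M' : Type*} [TopologicalSpace M'] {p : M' → M}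
  {D : M' → RealProj n}

theorem isMorphism_id (P : ProjectiveStructure n M) : P.IsMorphism (id : M → M) :=
  ⟨contMDiff_id, P.compatible⟩

namespace IsDevelopingMap

theorem map_nhds (hD : P.IsDevelopingMap p D) (hp : IsCoveringMap p) (z : M') :
    Filter.map D (𝓝 z) = 𝓝 (D z) := by
  obtain ⟨e, he, hz⟩ := P.cover (p z)
  obtain ⟨g, hg⟩ := hD z e he hz
  have h1 : Filter.map D (𝓝 z) = Filter.map (fun w => g • e (p w)) (𝓝 z) := Filter.map_congr hg
  rw [h1, hg.self_of_nhds]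
  have h2 : (fun w => g • e (p w)) = (fun x : RealProj n => g • x) ∘ e ∘ p := rfl
  rw [h2, ← Filter.map_map, ← Filter.map_map, hp.isLocalHomeomorph.map_nhds_eq, e.map_nhds_eq hz]
  exact (Homeomorph.smul g).map_nhds_eq _

theorem isOpenEmbedding (hD : P.IsDevelopingMap p D) (hp : IsCoveringMap p)
    (hinj : Function.Injective D) : Topology.IsOpenEmbedding D :=
  .of_continuous_injective_isOpenMap
    (continuous_iff_continuousAt.2 fun z => (hD.map_nhds hp z).le) hinj
    (IsOpenMap.of_nhds_le fun z => (hD.map_nhds hp z).ge)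

/-- Local path connectedness, required for lifting maps out of `M'`, is inherited from projective
space through the open embedding. -/
theorem locallyPathConnectedSpace (hD : P.IsDevelopingMap p D) (hp : IsCoveringMap p)
    (hinj : Function.Injective D) : LocallyPathConnectedSpace M' := by
  have : LocallyPathConnectedSpace (RealProj n) :=
    ChartedSpace.locallyPathConnectedSpace (EuclideanSpace ℝ (Fin n)) (RealProj n)
  exact (hD.isOpenEmbedding hp hinj).locallyPathConnectedSpace

/-- Read through the developing map, a lift of a morphism of the projective structure is the
restriction of a single projective transformation. -/
theorem exists_smul_eq_of_lift [PreconnectedSpace M'] [Nonempty M'] (hD : P.IsDevelopingMap p D)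
    (hp : IsCoveringMap p) {f : M → M} (hf : P.IsMorphism f) {F : M' → M'} (hF : Continuous F)
    (hFp : ∀ x, p (F x) = f (p x)) :
    ∃ g : GL (Fin (n + 1)) ℝ, ∀ w, D (F w) = g • D w := by
  have hloc : ∀ z, ∃ g : PGL(Fin (n + 1), ℝ), ∀ᶠ w in 𝓝 z, D (F w) = g • D w := by
    intro z
    obtain ⟨e, he, hz⟩ := P.cover (p z)
    obtain ⟨g, hg⟩ := hD z e he hz
    obtain ⟨e', he', hz'⟩ := P.cover (p (F z))
    obtain ⟨g', hg'⟩ := hD (F z) e' he' hz'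
    obtain ⟨a, ha⟩ := hf.2 e he e' he' (p z) hz (by rwa [← hFp])
    refine ⟨g' * a * g⁻¹, ?_⟩
    filter_upwards [hg, hF.continuousAt.eventually hg', hp.continuous.continuousAt.eventually ha]
      with w h1 h2 h3
    rw [h2, hFp, h3, h1, mul_smul, mul_smul, inv_smul_smul]
  obtain ⟨z₀⟩ := ‹Nonempty M'›
  obtain ⟨g, hg⟩ := hloc z₀
  have hop : IsOpen {z | ∀ᶠ w in 𝓝 z, D (F w) = g • D w} := isOpen_setOfPred_eventually_nhds
  -- Continuation: where the local expressions by g and g' overlap they agree on an open set, so g =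
  -- g'.
  have hcl : IsClosed {z | ∀ᶠ w in 𝓝 z, D (F w) = g • D w} := by
    rw [← isOpen_compl_iff, isOpen_iff_mem_nhds]
    intro z hz
    obtain ⟨g', hg'⟩ := hloc z
    filter_upwards [eventually_eventually_nhds.2 hg'] with w hw hw'
    have h1 : ∀ᶠ x in 𝓝 w, g • D x = g' • D x := by
      filter_upwards [hw, hw'] with x h2 h3
      rw [← h2, ← h3]
    rw [← Filter.eventually_map (P := fun y => g • y = g' • y), hD.map_nhds hp,
      eventually_nhds_iff] at h1
    obtain ⟨B, hB1, hB2, hB3⟩ := h1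
    obtain rfl := RealProj.PGL_eq_of_smul_eq hB2 ⟨_, hB3⟩ g g' hB1
    exact hz hg'
  have huniv := IsClopen.eq_univ ⟨hcl, hop⟩ ⟨z₀, hg⟩
  obtain ⟨k, rfl⟩ := Matrix.ProjGenLinGroup.mk_surjective g
  refine ⟨k, fun w => ?_⟩
  have : w ∈ {z | ∀ᶠ w in 𝓝 z, D (F w) = Matrix.ProjGenLinGroup.mk k • D w} :=
    huniv ▸ Set.mem_univ w
  rw [this.self_of_nhds, RealProj.PGL_mk_smul]

end IsDevelopingMap

/-- The matrices which represent the holonomy of the deck transformations. -/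
def holonomy {n : ℕ} {M M' : Type*} [TopologicalSpace M'] (p : M' → M) (D : M' → RealProj n) :
    Set (GL (Fin (n + 1)) ℝ) :=
  {g | ∃ δ : M' → M', Continuous δ ∧ (∀ x, p (δ x) = p x) ∧ ∀ w, D (δ w) = g • D w}

/-- Deck transformations are the lifts of the identity; simple connectedness makes them transitive
on fibres. -/
theorem IsDevelopingMap.exists_holonomy [SimplyConnectedSpace M'] (hD : P.IsDevelopingMap p D)
    (hp : IsCoveringMap p) (hinj : Function.Injective D) {z w : M'} (h : p z = p w) :
    ∃ g ∈ holonomy p D, ∃ δ : M' → M', (∀ x, p (δ x) = p x) ∧ (∀ x, D (δ x) = g • D x) ∧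
      δ z = w := by
  have := hD.locallyPathConnectedSpace hp hinj
  obtain ⟨δ, hδ, hδp, hδz⟩ := hp.exists_lift continuous_id (z := z) (w := w) h.symm
  obtain ⟨g, hg⟩ := hD.exists_smul_eq_of_lift hp P.isMorphism_id hδ hδp
  exact ⟨g, ⟨δ, hδ, hδp, hg⟩, δ, hδp, hg, hδz⟩

/-- A circle of projective transformations which commutes with the holonomy preserves the
developing image. -/
theorem exists_smul_mem_range [CompactSpace M] [ConnectedSpace M] [SimplyConnectedSpace M']
    (hD : P.IsDevelopingMap p D) (hp : IsCoveringMap p) (hsurj : Function.Surjective p)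
    (hinj : Function.Injective D)
    {B : Circle →* GL (Fin (n + 1)) ℝ}
    (hB : ∀ i j, ContMDiff (𝓡 1) 𝓘(ℝ, ℝ) ∞ fun z => (B z).1 i j)
    (hcomm : ∀ g ∈ holonomy p D, ∀ z, g * B z = B z * g) (z : Circle) (w : M') :
    ∃ w', D w' = B z • D w := by
  have hDo := hD.isOpenEmbedding hp hinj
  have hact : Continuous fun q : Circle × RealProj n => B q.1 • q.2 :=
    (RealProj.contMDiff_gl_smul hB).continuous
  -- Because `B` commutes with the holonomy, the condition depends only on the point of M below w,
  -- so compactness of M gives a uniform neighbourhood of 1.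
  have hev : ∀ᶠ z in 𝓝 (1 : Circle), ∀ m ∈ (Set.univ : Set M), ∀ w, p w = m →
      B z • D w ∈ Set.range D := by
    refine isCompact_univ.eventually_forall_of_forall_eventually fun m _ => ?_
    obtain ⟨w₀, rfl⟩ := hsurj m
    have h1 : ∀ᶠ q : Circle × M' in 𝓝 (1, w₀), B q.1 • D q.2 ∈ Set.range D := by
      have hc : Continuous fun q : Circle × M' => B q.1 • D q.2 :=
        hact.comp (continuous_fst.prodMk (hDo.continuous.comp continuous_snd))
      exact hc.continuousAt.eventually (hDo.isOpen_range.mem_nhds (by simp))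
    rw [nhds_prod_eq] at h1 ⊢
    obtain ⟨pa, ha, pb, hb, hab⟩ := Filter.eventually_prod_iff.1 h1
    rw [Filter.eventually_prod_iff]
    refine ⟨pa, ha, fun m => ∃ w, p w = m ∧ pb w, ?_, ?_⟩
    · rw [← hp.isLocalHomeomorph.map_nhds_eq, Filter.eventually_map]
      filter_upwards [hb] with w hw using ⟨w, rfl, hw⟩
    · rintro z hz _ ⟨w, rfl, hw⟩ w' hw'
      obtain ⟨g, hg, δ, hδp, hδ, rfl⟩ := hD.exists_holonomy hp hinj hw'.symm
      obtain ⟨v, hv⟩ := hab hz hw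
      refine ⟨δ v, ?_⟩
      rw [hδ, hδ, hv, ← mul_smul, ← mul_smul, hcomm g hg]
  -- An open subgroup of the connected circle is everything. Including inverses in the condition
  -- makes it a subgroup.
  let K : Subgroup Circle :=
    { carrier := {z | (∀ w, B z • D w ∈ Set.range D) ∧ ∀ w, B z⁻¹ • D w ∈ Set.range D}
      one_mem' := by simp
      mul_mem' := by
        rintro a b ⟨ha, ha'⟩ ⟨hb, hb'⟩
        refine ⟨fun w => ?_, fun w => ?_⟩
        · obtain ⟨v, hv⟩ := hb w
          rw [map_mul, mul_smul, ← hv]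
          exact ha v
        · obtain ⟨v, hv⟩ := ha' w
          rw [mul_inv_rev, map_mul, mul_smul, ← hv]
          exact hb' v
      inv_mem' := by
        rintro a ⟨ha, ha'⟩
        exact ⟨ha', by simpa using ha⟩ }
  have hK : (K : Set Circle) ∈ 𝓝 (1 : Circle) := by
    have hinv : Filter.Tendsto (fun z : Circle => z⁻¹) (𝓝 1) (𝓝 1) := by
      simpa using (continuous_inv (G := Circle)).tendsto 1
    filter_upwards [hev, hinv.eventually hev] with z h1 h2
    exact ⟨fun w => h1 _ trivial w rfl, fun w => h2 _ trivial w rfl⟩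
  have hKo : IsOpen (K : Set Circle) := K.isOpen_of_mem_nhds hK
  have huniv := IsClopen.eq_univ ⟨K.isClosed_of_isOpen hKo, hKo⟩ ⟨1, K.one_mem⟩
  have hz : z ∈ (K : Set Circle) := huniv ▸ Set.mem_univ z
  exact hz.1 w

end ProjectiveStructure

/-! ### Descending the circle action to M -/

namespace ProjectiveStructure

variable {n : ℕ} {M : Type*} [TopologicalSpace M] [ChartedSpace (EuclideanSpace ℝ (Fin n)) M]
  {P : ProjectiveStructure n M} {M' : Type*} [TopologicalSpace M'] {p : M' → M}
  {D : M' → RealProj n}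

/-- A nontrivial circle of projective transformations which commutes with the holonomy of an
injective developing map induces a nontrivial smooth circle action. -/
theorem exists_circle_action [CompactSpace M] [ConnectedSpace M] [SimplyConnectedSpace M']
    (hD : P.IsDevelopingMap p D) (hp : IsCoveringMap p) (hsurj : Function.Surjective p)
    (hinj : Function.Injective D) {B : Circle →* GL (Fin (n + 1)) ℝ}
    (hB : ∀ i j, ContMDiff (𝓡 1) 𝓘(ℝ, ℝ) ∞ fun z => (B z).1 i j)
    (hcomm : ∀ g ∈ holonomy p D, ∀ z, g * B z = B z * g)
    (hne : ∃ z, ∀ c : ℝ, (B z).1 ≠ c • 1) :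
    ∃ _ : MulAction Circle M,
      ContMDiff ((𝓡 1).prod (𝓡 n)) (𝓡 n) ∞ (fun q : Circle × M => q.1 • q.2) ∧
        ∃ (z : Circle) (x : M), z • x ≠ x := by
  have hDo := hD.isOpenEmbedding hp hinj
  -- Θ is the action transported to `M'` by D; it commutes with deck transformations.
  choose Θ hΘ using exists_smul_mem_range hD hp hsurj hinj hB hcomm
  have hΘ1 : ∀ w, Θ 1 w = w := fun w => hinj (by rw [hΘ, map_one, one_smul])
  have hΘmul : ∀ a b w, Θ (a * b) w = Θ a (Θ b w) := fun a b w =>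
    hinj (by rw [hΘ, hΘ, hΘ, map_mul, mul_smul])
  have hΘp : ∀ z w w', p w = p w' → p (Θ z w) = p (Θ z w') := by
    intro z w w' h
    obtain ⟨g, hg, δ, hδp, hδ, rfl⟩ := hD.exists_holonomy hp hinj h
    have : Θ z (δ w) = δ (Θ z w) := hinj (by
      rw [hΘ, hδ, hδ, hΘ, ← mul_smul, ← mul_smul, hcomm g hg])
    rw [this, hδp]
  have hΘc : Continuous fun q : Circle × M' => Θ q.1 q.2 := by
    rw [hDo.isInducing.continuous_iff]
    have h1 : Continuous fun q : Circle × M' => B q.1 • D q.2 :=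
      (RealProj.contMDiff_gl_smul hB).continuous.comp
        (continuous_fst.prodMk (hDo.continuous.comp continuous_snd))
    exact h1.congr fun q => (hΘ q.1 q.2).symm
  choose s hs using hsurj
  let act : MulAction Circle M :=
    { smul := fun z m => p (Θ z (s m))
      one_smul := fun m => by
        show p (Θ 1 (s m)) = m
        rw [hΘ1, hs]
      mul_smul := fun a b m => by
        show p (Θ (a * b) (s m)) = p (Θ a (s (p (Θ b (s m)))))
        rw [hΘmul]
        exact hΘp _ _ _ (hs _).symm }
  have hact : ∀ z w, z • p w = p (Θ z w) := fun z w => hΘp _ _ _ (hs _)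
  refine ⟨act, ?_, ?_⟩
  · rintro ⟨z₀, m₀⟩
    obtain ⟨w₀, rfl⟩ : ∃ w, p w = m₀ := ⟨_, hs m₀⟩
    obtain ⟨φ, hφ, hpφ⟩ := hp.isLocalHomeomorph w₀
    have hφt : p w₀ ∈ φ.target := by
      rw [hpφ]
      exact φ.map_source hφ
    have hφs : φ.symm (p w₀) = w₀ := by
      rw [hpφ]
      exact φ.left_inv hφ
    have hpσ : ∀ m ∈ φ.target, p (φ.symm m) = m := by
      rw [hpφ]
      exact fun m hm => φ.right_inv hm
    have hσc : ContinuousAt φ.symm (p w₀) := φ.symm.continuousAt hφt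
    obtain ⟨e, he, hze⟩ := P.cover (p w₀)
    obtain ⟨g, hg⟩ := hD w₀ e he hze
    obtain ⟨e', he', hze'⟩ := P.cover (p (Θ z₀ w₀))
    obtain ⟨g', hg'⟩ := hD _ e' he' hze'
    have hq : ContinuousAt (fun q : Circle × M => Θ q.1 (φ.symm q.2)) (z₀, p w₀) := by
      have h1 : ContinuousAt (fun q : Circle × M => (q.1, φ.symm q.2)) (z₀, p w₀) :=
        continuousAt_fst.prodMk
          (ContinuousAt.comp (g := φ.symm) (f := Prod.snd) hσc continuousAt_snd)
      exact hΘc.continuousAt.comp h1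
    have hq₀ : Θ (z₀, p w₀).1 (φ.symm (z₀, p w₀).2) = Θ z₀ w₀ := by simp [hφs]
    have hsrc : ∀ᶠ w in 𝓝 (Θ z₀ w₀), p w ∈ e'.source :=
      hp.continuous.continuousAt.eventually (e'.open_source.mem_nhds hze')
    have ev1 : ∀ᶠ q : Circle × M in 𝓝 (z₀, p w₀), p (Θ q.1 (φ.symm q.2)) ∈ e'.source ∧
        D (Θ q.1 (φ.symm q.2)) = g' • e' (p (Θ q.1 (φ.symm q.2))) := by
      have h1 := hsrc.and hg'
      rw [← hq₀] at h1
      exact hq.eventually h1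
    have ev2 : ∀ᶠ q : Circle × M in 𝓝 (z₀, p w₀), q.2 ∈ φ.target ∧
        D (φ.symm q.2) = g • e (p (φ.symm q.2)) := by
      have h1 : ∀ᶠ m in 𝓝 (p w₀), D (φ.symm m) = g • e (p (φ.symm m)) :=
        hσc.eventually (by rwa [hφs])
      have h2 : ∀ᶠ m in 𝓝 (p w₀), m ∈ φ.target := φ.open_target.mem_nhds hφt
      exact (continuous_snd.tendsto (z₀, p w₀)).eventually (h2.and h1)
    -- In charts the action is the linear one between two fixed projective maps, hence smooth.
    have key : ∀ᶠ q : Circle × M in 𝓝 (z₀, p w₀),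
        e' (p (Θ q.1 (φ.symm q.2))) = g'⁻¹ • (B q.1 • (g • e q.2)) ∧
          q.1 • q.2 = e'.symm (g'⁻¹ • (B q.1 • (g • e q.2))) := by
      filter_upwards [ev1, ev2] with q ⟨h1, h2⟩ ⟨h3, h4⟩
      have h5 : e' (p (Θ q.1 (φ.symm q.2))) = g'⁻¹ • (B q.1 • (g • e q.2)) := by
        rw [eq_inv_smul_iff, ← h2, hΘ, h4, hpσ _ h3]
      refine ⟨h5, ?_⟩
      conv_lhs => rw [← hpσ _ h3]
      rw [hact, ← h5, e'.left_inv h1]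
    have htgt : g'⁻¹ • (B z₀ • (g • e (p w₀))) ∈ e'.target := by
      have := key.self_of_nhds.1
      simp only [hφs] at this
      rw [← this]
      exact e'.map_source hze'
    have hsm1 : ContMDiffAt ((𝓡 1).prod (𝓡 n)) (𝓡 n) ∞ (fun q : Circle × M => g • e q.2)
        (z₀, p w₀) :=
      ContMDiffAt.comp (z₀, p w₀) (g := fun m => g • e m) (f := Prod.snd)
        ((RealProj.contMDiff_PGL_smul g).contMDiffAt.comp _
          ((P.smooth e he).contMDiffAt (e.open_source.mem_nhds hze))) contMDiffAt_snd
    have hsm2 : ContMDiffAt ((𝓡 1).prod (𝓡 n)) (𝓡 n) ∞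
        (fun q : Circle × M => g'⁻¹ • (B q.1 • (g • e q.2))) (z₀, p w₀) := by
      refine (RealProj.contMDiff_PGL_smul g'⁻¹).contMDiffAt.comp (z₀, p w₀) ?_
      exact ContMDiffAt.comp (z₀, p w₀) (g := fun q : Circle × RealProj n => B q.1 • q.2)
        (f := fun q : Circle × M => (q.1, g • e q.2))
        (RealProj.contMDiff_gl_smul hB).contMDiffAt (contMDiffAt_fst.prodMk hsm1)
    have hsm3 : ContMDiffAt (𝓡 n) (𝓡 n) ∞ e'.symm (g'⁻¹ • (B z₀ • (g • e (p w₀)))) :=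
      (P.smooth_symm e' he').contMDiffAt (e'.open_target.mem_nhds htgt)
    refine (ContMDiffAt.comp (z₀, p w₀) (g := e'.symm)
      (f := fun q : Circle × M => g'⁻¹ • (B q.1 • (g • e q.2))) hsm3 hsm2).congr_of_eventuallyEq ?_
    filter_upwards [key] with q hq using hq.2
  · by_contra! hcon
    obtain ⟨z, hz⟩ := hne
    -- If the action on M is trivial, each orbit in `M'` is a connected subset of a discrete fibre,
    -- hence a point.
    have hfix : ∀ w, Θ z w = w := by
      intro w
      have h1 : Continuous fun z => Θ z w := hΘc.comp (by fun_prop : Continuous fun z => (z, w))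
      have := hp.const_of_comp h1 (fun a b => by rw [← hact, ← hact, hcon, hcon]) z 1
      rw [this, hΘ1]
    obtain ⟨c, -, hc⟩ := RealProj.eq_smul_one_of_smul_eq hDo.isOpen_range
      (Set.range_nonempty D) (B z) (by
        rintro _ ⟨w, rfl⟩
        rw [← hΘ, hfix])
    exact hz c hc

end ProjectiveStructure

/-! ### Commutators with matrices near the identity -/

namespace RealProj

variable {n : ℕ}

theorem exists_gl_coe_eq_smul (g : GL (Fin (n + 1)) ℝ) {c : ℝ} (hc : c ≠ 0) :
    ∃ g' : GL (Fin (n + 1)) ℝ, g'.1 = c • g.1 ∧ ∀ x : RealProj n, g' • x = g • x := by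
  refine ⟨Matrix.GeneralLinearGroup.scalar _ (Units.mk0 c hc) * g, ?_, fun x => ?_⟩
  · ext i j
    simp
  · rw [← PGL_mk_smul, ← PGL_mk_smul, map_mul, Matrix.ProjGenLinGroup.mk_scalar, one_mul]

/-- The commutator of an invertible matrix with one close to the identity is close to the
identity. -/
theorem tendsto_mul_inv_mul_inv (d : GL (Fin (n + 1)) ℝ) :
    Filter.Tendsto (fun G : Matrix (Fin (n + 1)) (Fin (n + 1)) ℝ => G * d.1 * G⁻¹ * d⁻¹.1)
      (𝓝 1) (𝓝 1) := by
  have h1 : ContinuousAt (fun G : Matrix (Fin (n + 1)) (Fin (n + 1)) ℝ => G⁻¹) 1 := by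
    simp only [Matrix.inv_def, Ring.inverse_eq_inv']
    exact (continuous_id.matrix_det.continuousAt.inv₀ (by simp)).smul
      continuous_id.matrix_adjugate.continuousAt
  have h2 : ContinuousAt
      (fun G : Matrix (Fin (n + 1)) (Fin (n + 1)) ℝ => G * d.1 * G⁻¹ * d⁻¹.1) 1 :=
    ((continuousAt_id.mul continuousAt_const).mul h1).mul continuousAt_const
  have h3 : (1 : Matrix (Fin (n + 1)) (Fin (n + 1)) ℝ) * d.1 * 1⁻¹ * d⁻¹.1 = 1 := by
    rw [inv_one, one_mul, mul_one, ← Units.val_mul, mul_inv_cancel, Units.val_one]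
  have := h2.tendsto
  rwa [h3] at this

/-- Membership in U will show that a commutator with a deck transformation stays in a sheet; the
positive entry will fix the sign of a scalar commutator. -/
theorem eventually_commutator_smul_mem (d : GL (Fin (n + 1)) ℝ) {x : RealProj n}
    {U : Set (RealProj n)} (hU : IsOpen U) (hx : x ∈ U) :
    ∀ᶠ G : Matrix (Fin (n + 1)) (Fin (n + 1)) ℝ in 𝓝 1, ∀ g : GL (Fin (n + 1)) ℝ, g.1 = G →
      (g * d * g⁻¹ * d⁻¹) • x ∈ U ∧ 0 < (g * d * g⁻¹ * d⁻¹).1 0 0 := by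
  induction x using Projectivization.ind with
  | h v hv =>
    have h1 : ∀ᶠ G : Matrix (Fin (n + 1)) (Fin (n + 1)) ℝ in 𝓝 1, G.mulVec v ∈ cone U := by
      have hc : Continuous fun G : Matrix (Fin (n + 1)) (Fin (n + 1)) ℝ => G.mulVec v :=
        continuous_id.matrix_mulVec continuous_const
      refine hc.continuousAt.eventually ((isOpen_cone hU).mem_nhds ?_)
      show (1 : Matrix (Fin (n + 1)) (Fin (n + 1)) ℝ).mulVec v ∈ cone U
      rw [Matrix.one_mulVec]
      exact ⟨hv, hx⟩
    have h2 : ∀ᶠ G : Matrix (Fin (n + 1)) (Fin (n + 1)) ℝ in 𝓝 1, 0 < G 0 0 := by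
      have hc : Continuous fun G : Matrix (Fin (n + 1)) (Fin (n + 1)) ℝ => G 0 0 :=
        continuous_id.matrix_elem 0 0
      exact hc.continuousAt.eventually (lt_mem_nhds (by simp))
    filter_upwards [(tendsto_mul_inv_mul_inv d).eventually (h1.and h2)] with G hG g hg
    subst hg
    rw [← Matrix.coe_units_inv] at hG
    obtain ⟨⟨h3, h4⟩, h5⟩ := hG
    exact ⟨h4, h5⟩

/-- A commutator has determinant 1, so c raised to n + 1 is 1; positivity excludes c = -1. -/
theorem commute_of_commutator_eq_smul_one {g d : GL (Fin (n + 1)) ℝ} {c : ℝ}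
    (hc : (g * d * g⁻¹ * d⁻¹).1 = c • 1) (hpos : 0 < (g * d * g⁻¹ * d⁻¹).1 0 0) :
    d * g = g * d := by
  have h1 : 0 < c := by simpa [hc] using hpos
  have h2 : (g * d * g⁻¹ * d⁻¹).1.det = 1 := by
    have : Matrix.GeneralLinearGroup.det (g * d * g⁻¹ * d⁻¹) = 1 := by
      simp only [map_mul, map_inv]
      rw [mul_right_comm, mul_inv_cancel_right, mul_inv_cancel]
    exact congrArg Units.val this
  rw [hc, Matrix.det_smul, Matrix.det_one, mul_one, Fintype.card_fin,
    pow_eq_one_iff_of_nonneg h1.le (by omega)] at h2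
  rw [h2, one_smul] at hc
  have h3 : g * d * g⁻¹ * d⁻¹ = 1 := Units.ext hc
  rw [mul_inv_eq_one, mul_inv_eq_iff_eq_mul] at h3
  exact h3.symm

end RealProj

/-! ### Automorphisms near the identity centralize the holonomy -/

namespace ProjectiveStructure

variable {n : ℕ} {M : Type*} [TopologicalSpace M] [ChartedSpace (EuclideanSpace ℝ (Fin n)) M]
  {P : ProjectiveStructure n M} {M' : Type*} [TopologicalSpace M'] {p : M' → M}
  {D : M' → RealProj n}

theorem continuous_coe_aut :
    Continuous fun f : P.aut => ((f : M ≃ₜ M) : C(M, M)) := by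
  have h : Continuous fun f : M ≃ₜ M => (f : C(M, M)) := continuous_induced_dom
  exact h.comp continuous_subtype_val

/-- A lift of an automorphism close to the identity which starts in a sheet at a base point stays
in that sheet at a point joined to the base point inside the sheet. -/
theorem eventually_lift_eq (hp : IsCoveringMap p) (φ : OpenPartialHomeomorph M' M) (hφ : p = φ)
    {z b : M'} (hzb : JoinedIn φ.source z b) :
    ∀ᶠ f : P.aut in 𝓝 1, f.1 (p z) ∈ φ.target ∧ ∀ F : M' → M', Continuous F →
      (∀ x, p (F x) = f.1 (p x)) → F z = φ.symm (f.1 (p z)) → F b = φ.symm (f.1 (p b)) := by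
  let γ := hzb.somePath
  have hγ : ∀ t, γ t ∈ φ.source := hzb.somePath_mem
  have hK : IsCompact (p '' Set.range γ) :=
    (isCompact_range γ.continuous).image hp.continuous
  have hev : ∀ᶠ f : P.aut in 𝓝 1, Set.MapsTo ((f : M ≃ₜ M) : C(M, M)) (p '' Set.range γ)
      φ.target := by
    refine continuous_coe_aut.continuousAt.eventually
      ((ContinuousMap.isOpen_setOfPred_mapsTo hK φ.open_target).mem_nhds ?_)
    rintro _ ⟨_, ⟨t, rfl⟩, rfl⟩
    show p (γ t) ∈ φ.target
    rw [hφ]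
    exact φ.map_source (hγ t)
  filter_upwards [hev] with f hf
  have hz : z ∈ Set.range γ := ⟨0, γ.source⟩
  have hb : b ∈ Set.range γ := ⟨1, γ.target⟩
  refine ⟨hf ⟨z, hz, rfl⟩, fun F hF hFp hFz => ?_⟩
  have hcont : ContinuousOn (fun x => φ.symm (f.1 (p x))) (Set.range γ) :=
    φ.symm.continuousOn.comp (f.1.continuous.comp hp.continuous).continuousOn
      fun x hx => hf ⟨x, hx, rfl⟩
  -- Uniqueness of lifts along the path, whose image under f ∘ p stays in the evenly projected set.
  refine hp.eqOn_of_comp_eqOn (isPreconnected_range γ.continuous) hF.continuousOn hcont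
    (fun x hx => ?_) hz hFz hb
  have := φ.right_inv (hf ⟨x, hx, rfl⟩)
  rw [← hφ] at this
  simp only [Function.comp_apply, hFp]
  exact this.symm

/-- The automorphisms which lift to a projective transformation commuting with the holonomy, paired
with that transformation. -/
def centralizingLifts (P : ProjectiveStructure n M) (p : M' → M) (D : M' → RealProj n) :
    Subgroup (Subgroup.centralizer (holonomy p D) × P.aut) where
  carrier := {q | (∀ z, ∃ w, p w = q.2.1 (p z) ∧ D w = q.1.1 • D z) ∧
    ∀ z, ∃ w, p w = q.2⁻¹.1 (p z) ∧ D w = q.1⁻¹.1 • D z}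
  one_mem' := ⟨fun z => ⟨z, rfl, (one_smul _ _).symm⟩, fun z => ⟨z, by simp, by simp⟩⟩
  mul_mem' := by
    rintro a b ⟨ha, ha'⟩ ⟨hb, hb'⟩
    refine ⟨fun z => ?_, fun z => ?_⟩
    · obtain ⟨w, h1, h2⟩ := hb z
      obtain ⟨v, h3, h4⟩ := ha w
      exact ⟨v, by rw [h3, h1]; rfl, by rw [h4, h2, ← mul_smul]; rfl⟩
    · obtain ⟨w, h1, h2⟩ := ha' z
      obtain ⟨v, h3, h4⟩ := hb' w
      refine ⟨v, ?_, ?_⟩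
      · rw [h3, h1, Prod.snd_mul, mul_inv_rev]; rfl
      · rw [h4, h2, ← mul_smul, Prod.fst_mul, mul_inv_rev]; rfl
  inv_mem' := by
    rintro a ⟨ha, ha'⟩
    exact ⟨ha', by simpa using ha⟩

/-- The matrix determines the automorphism: if it is 1, injectivity of D makes the lift, hence the
automorphism, trivial. -/
theorem isSolvable_centralizingLifts (hsurj : Function.Surjective p) (hinj : Function.Injective D)
    [Group.IsSolvable (Subgroup.centralizer (holonomy p D))] :
    Group.IsSolvable (centralizingLifts P p D) := by
  let F : centralizingLifts P p D →* Subgroup.centralizer (holonomy p D) :=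
    (MonoidHom.fst _ _).comp (centralizingLifts P p D).subtype
  refine Group.isSolvable_of_isSolvable_injective (f := F)
    ((injective_iff_map_eq_one F).2 fun q hq => ?_)
  have hq1 : q.1.1 = 1 := hq
  refine Subtype.ext (Prod.ext hq1 (Subtype.ext (Homeomorph.ext fun m => ?_)))
  obtain ⟨z, rfl⟩ := hsurj m
  obtain ⟨w, h1, h2⟩ := q.2.1 z
  rw [hq1] at h2
  have : w = z := hinj (by rw [h2]; exact one_smul _ _)
  rw [← h1, this]
  rfl

/-- The automorphisms close to the identity lift to projective transformations which commute with
the holonomy. -/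
theorem eventually_mem_map_snd [T2Space M] [CompactSpace M] [SimplyConnectedSpace M']
    (hD : P.IsDevelopingMap p D) (hp : IsCoveringMap p) (hinj : Function.Injective D) :
    ∀ᶠ f : P.aut in 𝓝 1, f ∈ (centralizingLifts P p D).map (MonoidHom.snd _ _) := by
  have hDo := hD.isOpenEmbedding hp hinj
  have := hD.locallyPathConnectedSpace hp hinj
  obtain ⟨z₀⟩ : Nonempty M' := inferInstance
  obtain ⟨φ, hφ, hpφ⟩ := hp.isLocalHomeomorph z₀
  obtain ⟨S, hS, hSfin, hScen⟩ := Matrix.exists_finite_centralizer (holonomy p D)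
  have hsrc : IsOpen (D '' φ.source) := hDo.isOpenMap _ φ.open_source
  have hV := (Set.Finite.eventually_all hSfin).2 fun d (_ : d ∈ S) =>
    RealProj.eventually_commutator_smul_mem d hsrc ⟨z₀, hφ, rfl⟩
  -- The frame is taken in this path component so that its points are joined to `z₀` inside the
  -- sheet, which keeps track of the lift there.
  have hNo : IsOpen (pathComponentIn φ.source z₀) := φ.open_source.pathComponentIn z₀
  obtain ⟨v, hli, hv, hs⟩ := RealProj.exists_frame (hDo.isOpenMap _ hNo)
    ⟨D z₀, z₀, mem_pathComponentIn_self hφ, rfl⟩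
  choose hv0 b hbN hb using hv
  obtain ⟨hs0, a, haN, ha⟩ := hs
  have hfr := RealProj.eventually_exists_smul_mem hli hv0 hs0 hV
  have hlim : ∀ x ∈ pathComponentIn φ.source z₀,
      Filter.Tendsto (fun f : P.aut => D (φ.symm (f.1 (p x)))) (𝓝 1) (𝓝 (D x)) := by
    intro x hx
    have hxs : x ∈ φ.source := pathComponentIn_subset hx
    have h1 : Filter.Tendsto (fun f : P.aut => f.1 (p x)) (𝓝 1) (𝓝 (p x)) :=
      ((continuous_eval_const (p x)).comp continuous_coe_aut).tendsto 1
    have h2 : ContinuousAt φ.symm (p x) := by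
      rw [hpφ]
      exact φ.symm.continuousAt (φ.map_source hxs)
    have h3 : φ.symm (p x) = x := by
      rw [hpφ]
      exact φ.left_inv hxs
    have h4 := hDo.continuous.continuousAt.tendsto.comp (h2.tendsto.comp h1)
    rwa [h3] at h4
  have hlim' : Filter.Tendsto (fun f : P.aut =>
      (fun i => D (φ.symm (f.1 (p (b i)))), D (φ.symm (f.1 (p a))))) (𝓝 1)
      (𝓝 (fun i => Projectivization.mk ℝ (v i) (hv0 i),
        Projectivization.mk ℝ (∑ i, v i) hs0)) := by
    rw [← ha]
    simp only [← hb]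
    exact (tendsto_pi_nhds.2 fun i => hlim _ (hbN i)).prodMk_nhds (hlim _ haN)
  filter_upwards [hlim'.eventually hfr, eventually_lift_eq hp φ hpφ haN,
    Filter.eventually_all.2 fun i => eventually_lift_eq hp φ hpφ (hbN i)]
    with f h1 ⟨h2, h3⟩ h4
  have hpz : p (φ.symm (f.1 (p z₀))) = f.1 (p z₀) := by
    have := φ.right_inv h2
    rwa [← hpφ] at this
  obtain ⟨F, hF, hFp, hFz⟩ := hp.exists_lift f.1.continuous hpz
  obtain ⟨F', hF', hFp', hFF', hF'F⟩ := hp.exists_inverse_lift f.1.symm.continuous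
    f.1.apply_symm_apply f.1.symm_apply_apply hF hFp
  obtain ⟨g₀, hg₀⟩ := hD.exists_smul_eq_of_lift hp f.2.1 hF hFp
  obtain ⟨c, hc0, hc⟩ := h1 g₀
    (fun i => by rw [← hb, ← hg₀, (h4 i).2 F hF hFp hFz])
    (by rw [← ha, ← hg₀, h3 F hF hFp hFz])
  -- The matrix is rescaled to lie near 1, without changing its projective action.
  obtain ⟨g, hg, hgg₀⟩ := RealProj.exists_gl_coe_eq_smul g₀ hc0
  have hgD : ∀ w, D (F w) = g • D w := fun w => by rw [hg₀, hgg₀]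
  have hgD' : ∀ w, D (F' w) = g⁻¹ • D w := fun w => by
    rw [eq_inv_smul_iff, ← hgD, hFF']
  have hcen : g ∈ Subgroup.centralizer (holonomy p D) := by
    refine hScen g fun d hd => ?_
    obtain ⟨hmem, hpos⟩ := hc d hd g hg
    obtain ⟨δ, hδ, hδp, hδD⟩ := hS hd
    obtain ⟨δ', hδ', hδp', hδδ', -⟩ := hp.exists_inverse_lift (f := id) (f' := id) continuous_id
      (fun _ => rfl) (fun _ => rfl) hδ hδp
    have hδD' : ∀ w, D (δ' w) = d⁻¹ • D w := fun w => by
      rw [eq_inv_smul_iff, ← hδD, hδδ']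
    have hκD : ∀ w, D (F (δ (F' (δ' w)))) = (g * d * g⁻¹ * d⁻¹) • D w := fun w => by
      rw [hgD, hδD, hgD', hδD', mul_smul, mul_smul, mul_smul]
    have hκp : ∀ w, p (F (δ (F' (δ' w)))) = p w := fun w => by
      rw [hFp, hδp, hFp', hδp']
      simp
    -- The commutator covers the identity and keeps `z₀` in a sheet on which p is injective, so it
    -- fixes `z₀`.
    have hκz : F (δ (F' (δ' z₀))) = z₀ := by
      rw [← hκD] at hmem
      obtain ⟨x, hx, hxz⟩ := hmem
      rw [← hinj hxz]
      refine φ.injOn hx hφ ?_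
      rw [← hpφ, hinj hxz, hκp]
    have hκ : ∀ w, F (δ (F' (δ' w))) = w :=
      congrFun (hp.eq_of_comp_eq (g₁ := fun w => F (δ (F' (δ' w))))
        (hF.comp (hδ.comp (hF'.comp hδ'))) continuous_id (funext hκp) z₀ hκz)
    obtain ⟨c', -, hc'⟩ := RealProj.eq_smul_one_of_smul_eq hDo.isOpen_range
      (Set.range_nonempty D) (g * d * g⁻¹ * d⁻¹) (by
        rintro _ ⟨w, rfl⟩
        rw [← hκD, hκ])
    exact RealProj.commute_of_commutator_eq_smul_one hc' hpos
  exact ⟨(⟨g, hcen⟩, f), ⟨fun z => ⟨F z, hFp z, hgD z⟩, fun z => ⟨F' z, hFp' z, hgD' z⟩⟩, rfl⟩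

end ProjectiveStructure

/-! ### Conclusion -/

theorem Subgroup.isSolvable_connectedComponentOfOne {G : Type*} [Group G] [TopologicalSpace G]
    [IsTopologicalGroup G] (H : Subgroup G) (hH : (H : Set G) ∈ 𝓝 (1 : G))
    [Group.IsSolvable H] : Group.IsSolvable (Subgroup.connectedComponentOfOne G) := by
  have ho := H.isOpen_of_mem_nhds hH
  have hle : Subgroup.connectedComponentOfOne G ≤ H :=
    isPreconnected_connectedComponent.subset_isClopen ⟨H.isClosed_of_isOpen ho, ho⟩
      ⟨1, mem_connectedComponent, H.one_mem⟩
  exact Group.isSolvable_of_isSolvable_injective (Subgroup.inclusion_injective hle)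

theorem proposition4p2 {n : ℕ} {M : Type*} [TopologicalSpace M] [T2Space M] [CompactSpace M]
    [ConnectedSpace M] [ChartedSpace (EuclideanSpace ℝ (Fin n)) M] [IsManifold (𝓡 n) ∞ M]
    (P : ProjectiveStructure n M)
    {M' : Type*} [TopologicalSpace M'] [SimplyConnectedSpace M'] (p : M' → M)
    (hp : IsCoveringMap p) (D : M' → RealProj n) (hD : P.IsDevelopingMap p D)
    (hinj : Function.Injective D)
    (hns : ¬ Group.IsSolvable (Subgroup.connectedComponentOfOne P.aut)) :
    ∃ _ : MulAction Circle M,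
      ContMDiff ((𝓡 1).prod (𝓡 n)) (𝓡 n) ∞ (fun q : Circle × M => q.1 • q.2) ∧
        ∃ (z : Circle) (x : M), z • x ≠ x := by
  have hM : LocallyPathConnectedSpace M :=
    ChartedSpace.locallyPathConnectedSpace (EuclideanSpace ℝ (Fin n)) M
  have hM' : PathConnectedSpace M := pathConnectedSpace_iff_connectedSpace.2 inferInstance
  have hsurj := hp.surjective_of_pathConnectedSpace
  obtain ⟨X, hX0, hX, hXc⟩ := Matrix.exists_cube_eq_neg_of_not_isSolvable_centralizer
    (S := ProjectiveStructure.holonomy p D) fun hsol => hns <| by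
      have := ProjectiveStructure.isSolvable_centralizingLifts (P := P) hsurj hinj
      let H : Subgroup P.aut := (ProjectiveStructure.centralizingLifts P p D).map
        (MonoidHom.snd (Subgroup.centralizer (ProjectiveStructure.holonomy p D)) P.aut)
      have : Group.IsSolvable H :=
        Group.isSolvable_of_surjective (MonoidHom.subgroupMap_surjective _ _)
      have hH : ∀ᶠ f in 𝓝 1, f ∈ H := ProjectiveStructure.eventually_mem_map_snd hD hp hinj
      exact H.isSolvable_connectedComponentOfOne hH
  exact ProjectiveStructure.exists_circle_action hD hp hsurj hinj (Matrix.contMDiff_rotation hX)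
    (fun g hg z => Matrix.rotation_commute hX (hXc g hg) z)
    (Matrix.exists_rotation_ne_smul_one hX hX0)
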